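/- Let $r\ge 0$, $L\ge 0$ be integers and $s\in\frac12\mathbb Z_{\ge 0}$. Let $\mathfrak{su}(r+1)$ act on $H=\big(\mathrm{Sym}^{2s}(\mathbb C^{r+1})\big)^{\otimes L}$, let $\alpha_i=e_i-e_{i+1}$ ($1\le i\le r$) be the simple roots and $\Delta^+=\{e_i-e_l:\ 1\le i<l\le r+1\}$ the positive roots. For $\alpha=e_i-e_l=\alpha_i+\dots+\alpha_{l-1}$ put $t^\alpha=t_it_{i+1}\cdots t_{l-1}$. **Partial twist.** Let $D^+\subset\Delta^+$, and let $B_1,\dots,B_k$ be the blocks of the finest partition of $\{1,\dots,r+1\}$ such that $i,l$ lie in the same block whenever $e_i-e_l\in D^+$. Put $\Delta_j^+=\{e_i-e_l\in\Delta^+:\ i,l\in B_j\}$, so that $\coprod_j\Delta_j^+$ is the smallest decomposition of $\Delta^+$ that contains $D^+$, and $\chi(\mathfrak g_j)^{-1}=\prod_{\alpha\in\Delta_j^+}(1-t^\alpha)$ (which is $1$ if $\Delta^+_j=\varnothing$). Let $\bigoplus_j\mathfrak g_j\subset\mathfrak{su}(r+1)$ be the unbroken subalgebra of rank $r$, spanned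 by the Cartan subalgebra of $\mathfrak{su}(r+1)$ and the $\mathfrak{su}(2)$'s of the roots in $\coprod_j\Delta_j^+$ (that is, the elements of $\mathfrak{su}(r+1)$ that are block diagonal for $B_1,\dots,B_k$). **Restricted-occupancy coefficients and shift operator.** For $\vec M\in\mathbb Z^r$ let $c_{s,L}(\vec M)$ be the coefficient of $x_1^{M_1}\cdots x_r^{M_r}$ in $\big[S_{(2s)}(1,x_1,x_1x_2,\dots,x_1\cdots x_r)\big]^L$ ($0$ if some $M_a<0$), where $S_\lambda(x_1,\dots,x_n)=\det(x_j^{\lambda_i+n-i})/\det(x_j^{n-i})$ is the Schur polynomial and $(2s)=(2s,0,\dots,0)$. For a polynomial $P$ in $t_1,\dots,t_r$ let $\mathcal D_Pf(\vec M)=\sum_{\beta}\mathrm{sgn}(\beta)\,f(\vec M-\beta)$, the sum running over the monomials $t^\beta$ that occur in $P$, with $\mathrm{sgn}(\beta)$ the sign of the coefficient of $t^\beta$. **Branching rule.** Let $\vec M\in\mathbb Z^r$ and $\lambda=(2sL-M_1,\,M_1-M_2,\,\dots,\,M_{r-1}-M_r,\,M_r)$, read as $(2sL)$ if $r=0$.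 Let $\Lambda=(\lambda^{(1)},\dots,\lambda^{(k)})$, where $\lambda^{(j)}$ consists of the rows $\lambda_i$, $i\in B_j$, in the same order as in $\lambda$. Assume that every $\lambda^{(j)}$ is a Young diagram (its rows are non-negative and weakly decreasing), and let $V_\Lambda$ be the irreducible representation of $\bigoplus_j\mathfrak g_j$ whose highest weight takes the value $\sum_j\sum_{i\in B_j}a_i\lambda_i$ on a diagonal matrix $\mathrm{diag}(a_1,\dots,a_{r+1})$ of the Cartan subalgebra. **Claim.** The restriction of $H$ to $\bigoplus_j\mathfrak g_j$ is a finite direct sum of irreducible representations, and in every such decomposition the number $\mu^{D^+}_\Lambda$ of summands isomorphic to $V_\Lambda$ is $$\mu^{D^+}_\Lambda=\mathcal D_{\prod_{j=1}^k\chi(\mathfrak g_j)^{-1}}\,c_{s,L}(\vec M).$$ In particular, for $D^+=\varnothing$ one has $\mu^{\varnothing}_\Lambda=c_{s,L}(\vec M)$. -/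

import Mathlib

open scoped TensorProduct

namespace PartialTwist

noncomputable section

attribute [local instance] LieRing.ofAssociativeRing

/-! ### Positive roots and the decomposition determined by a set of positive roots -/

/-- The positive roots `e_i - e_j`, `i < j`, of `su(r+1)`, with `i, j ∈ {0, …, r}`. -/
abbrev PosRoot (r : ℕ) : Type := {p : Fin (r + 1) × Fin (r + 1) // p.1 < p.2}

/-- The smallest decomposition determined by `D`. A decomposition
`su(r+1) ⟶ ⊕_j 𝔤_j` that keeps the Cartan subalgebra is a partition of the index set
`{0, …, r}` into blocks: `Δ_j⁺` consists of the `e_i - e_l` with `i < l` both in the `j`-th block.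
The partition determined by `D` is the intersection of all partitions whose roots contain `D`. -/
def blocks {r : ℕ} (D : Set (PosRoot r)) : Setoid (Fin (r + 1)) :=
  sInf {P : Setoid (Fin (r + 1)) | ∀ α ∈ D, P α.1.1 α.1.2}

/-- The index `j` of the summands `𝔤_j`. -/
abbrev Component {r : ℕ} (D : Set (PosRoot r)) : Type := Quotient (blocks D)

instance instFintypeComponent {r : ℕ} (D : Set (PosRoot r)) : Fintype (Component D) :=
  Fintype.ofFinite _

/-- The positive roots `Δ_j⁺` of the summand `𝔤_j` (empty for a one-element block). -/
def componentRoots {r : ℕ} (D : Set (PosRoot r)) (j : Component D) : Set (PosRoot r) :=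
  {α | (Quotient.mk (blocks D) α.1.1) = j ∧ (Quotient.mk (blocks D) α.1.2) = j}

/-! ### The unbroken subalgebra -/

/-- The real Lie algebra `su(n)` of traceless skew-Hermitian matrices. -/
def su (n : ℕ) : LieSubalgebra ℝ (Matrix (Fin n) (Fin n) ℂ) where
  carrier := {A | A.conjTranspose = -A ∧ A.trace = 0}
  add_mem' := by
    rintro A B ⟨hA, hA'⟩ ⟨hB, hB'⟩
    exact ⟨by rw [Matrix.conjTranspose_add, hA, hB, neg_add], by
      rw [Matrix.trace_add, hA', hB', add_zero]⟩
  zero_mem' := ⟨by simp, by simp⟩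
  smul_mem' := by
    rintro c A ⟨hA, hA'⟩
    exact ⟨by rw [Matrix.conjTranspose_smul, hA]; simp, by
      rw [Matrix.trace_smul, hA', smul_zero]⟩
  lie_mem' := by
    rintro A B ⟨hA, -⟩ ⟨hB, -⟩
    refine ⟨?_, ?_⟩
    · rw [Ring.lie_def, Matrix.conjTranspose_sub, Matrix.conjTranspose_mul,
        Matrix.conjTranspose_mul, hA, hB]
      simp
    · rw [Ring.lie_def, Matrix.trace_sub, Matrix.trace_mul_comm, sub_self]

/-- The subalgebra `⊕_j 𝔤_j` of `su(r+1)`, of rank `r`: the elements of `su(r+1)` that are block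
diagonal for the decomposition determined by `D`. It is spanned by the Cartan subalgebra of
`su(r+1)` and the `su(2)`'s of the roots in `∐_j Δ_j⁺`. -/
def unbroken {r : ℕ} (D : Set (PosRoot r)) :
    LieSubalgebra ℝ (Matrix (Fin (r + 1)) (Fin (r + 1)) ℂ) where
  carrier := {A | A ∈ su (r + 1) ∧ ∀ i l, ¬ blocks D i l → A i l = 0}
  add_mem' := by
    rintro A B ⟨hA, hA'⟩ ⟨hB, hB'⟩
    exact ⟨add_mem hA hB, fun i l h => by simp [hA' i l h, hB' i l h]⟩
  zero_mem' := ⟨zero_mem _, fun _ _ _ => rfl⟩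
  smul_mem' := by
    rintro c A ⟨hA, hA'⟩
    exact ⟨(su (r + 1)).smul_mem c hA, fun i l h => by simp [hA' i l h]⟩
  lie_mem' := by
    have key : ∀ A B : Matrix (Fin (r + 1)) (Fin (r + 1)) ℂ,
        (∀ i l, ¬ blocks D i l → A i l = 0) → (∀ i l, ¬ blocks D i l → B i l = 0) →
        ∀ i l, ¬ blocks D i l → (A * B) i l = 0 := by
      intro A B hA hB i l h
      rw [Matrix.mul_apply]
      refine Finset.sum_eq_zero fun m _ => ?_
      by_cases him : blocks D i m
      · rw [hB m l fun hml => h ((blocks D).trans' him hml), mul_zero]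
      · rw [hA i m him, zero_mul]
    rintro A B ⟨hA, hA'⟩ ⟨hB, hB'⟩
    refine ⟨(su (r + 1)).lie_mem hA hB, fun i l h => ?_⟩
    rw [Ring.lie_def, Matrix.sub_apply, key A B hA' hB' i l h, key B A hB' hA' i l h, sub_zero]

/-! ### The Hilbert space of the spin chain -/

/-- The matrix `A` acts on polynomials in `x_0, …, x_r` as the derivation
`∑_{i,l} A_{il} x_i ∂/∂x_l`, i.e. `x_l ↦ ∑_i A_{il} x_i`. -/
def polyAct {r : ℕ} (A : Matrix (Fin (r + 1)) (Fin (r + 1)) ℂ) :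
    MvPolynomial (Fin (r + 1)) ℂ →ₗ[ℂ] MvPolynomial (Fin (r + 1)) ℂ :=
  ∑ i, ∑ l, A i l •
    (LinearMap.mulLeft ℂ (MvPolynomial.X i) ∘ₗ (MvPolynomial.pderiv l).toLinearMap)

lemma polyAct_mem {r : ℕ} (A : Matrix (Fin (r + 1)) (Fin (r + 1)) ℂ) (k : ℕ)
    (f : MvPolynomial (Fin (r + 1)) ℂ)
    (hf : f ∈ MvPolynomial.homogeneousSubmodule (Fin (r + 1)) ℂ k) :
    polyAct A f ∈ MvPolynomial.homogeneousSubmodule (Fin (r + 1)) ℂ k := by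
  simp only [polyAct, LinearMap.sum_apply, LinearMap.smul_apply, LinearMap.comp_apply]
  refine Submodule.sum_mem _ fun i _ => Submodule.sum_mem _ fun l _ => Submodule.smul_mem _ _ ?_
  rw [MvPolynomial.mem_homogeneousSubmodule] at hf
  change MvPolynomial.X i * MvPolynomial.pderiv l f ∈ _
  rcases Nat.eq_zero_or_pos k with rfl | hk
  · obtain ⟨c, rfl⟩ : ∃ c, f = MvPolynomial.C c :=
      ⟨_, MvPolynomial.totalDegree_eq_zero_iff_eq_C.mp
        ((MvPolynomial.totalDegree_zero_iff_isHomogeneous _).mpr hf)⟩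
    simp
  · have h := (MvPolynomial.isHomogeneous_X ℂ i).mul (hf.pderiv (i := l))
    rwa [Nat.add_sub_cancel' hk] at h

/-- The `2s`-symmetric representation `Sym^{2s}(ℂ^{r+1})`, `k = 2s`: homogeneous polynomials of
degree `k` in `r + 1` variables. -/
abbrev Site (r k : ℕ) : Type := MvPolynomial.homogeneousSubmodule (Fin (r + 1)) ℂ k

/-- The action of a matrix on `Sym^k(ℂ^{r+1})`. -/
def siteAct {r : ℕ} (k : ℕ) (A : Matrix (Fin (r + 1)) (Fin (r + 1)) ℂ) :
    Site r k →ₗ[ℂ] Site r k :=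
  (polyAct A).restrict (polyAct_mem A k)

/-- The Hilbert space of the chain of length `L`, the `L`-fold tensor power of
`Sym^k(ℂ^{r+1})`. -/
abbrev Chain (r k L : ℕ) : Type := ⨂[ℂ] _ : Fin L, Site r k

/-- The action of a matrix on the chain: `∑_n 1 ⊗ ⋯ ⊗ A ⊗ ⋯ ⊗ 1`, `A` in the `n`-th place. -/
def chainAct {r : ℕ} (k L : ℕ) (A : Matrix (Fin (r + 1)) (Fin (r + 1)) ℂ) :
    Chain r k L →ₗ[ℂ] Chain r k L :=
  ∑ n : Fin L, PiTensorProduct.map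
    (Function.update (fun _ : Fin L => (LinearMap.id : Site r k →ₗ[ℂ] Site r k)) n (siteAct k A))

/-- `W` is a (complex) subrepresentation of the chain restricted to `⊕_j 𝔤_j`. -/
def IsInvariant {r k L : ℕ} (D : Set (PosRoot r)) (W : Submodule ℂ (Chain r k L)) : Prop :=
  ∀ A ∈ unbroken D, ∀ v ∈ W, chainAct k L A v ∈ W

/-- `W` is an irreducible subrepresentation of the chain restricted to `⊕_j 𝔤_j`. -/
def IsIrreducible {r k L : ℕ} (D : Set (PosRoot r)) (W : Submodule ℂ (Chain r k L)) : Prop :=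
  IsInvariant D W ∧ W ≠ ⊥ ∧ ∀ U : Submodule ℂ (Chain r k L), IsInvariant D U → U ≤ W → U = ⊥ ∨ U = W

/-- `H = W_1 ⊕ ⋯ ⊕ W_m`, each `W_i` an irreducible representation of `⊕_j 𝔤_j`. -/
def IsIrreducibleDecomposition {r k L m : ℕ} (D : Set (PosRoot r))
    (W : Fin m → Submodule ℂ (Chain r k L)) : Prop :=
  (∀ i, IsIrreducible D (W i)) ∧ DirectSum.IsInternal W

/-! ### Young diagrams and the branching rule -/

/-- The rows `λ = (kL - M_1, M_1 - M_2, …, M_{r-1} - M_r, M_r)`. -/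
def rows {r : ℕ} (k L : ℕ) (M : Fin r → ℤ) : Fin (r + 1) → ℤ := fun i =>
  (Fin.cons ((k : ℤ) * (L : ℤ)) M : Fin (r + 1) → ℤ) i - (Fin.snoc M 0 : Fin (r + 1) → ℤ) i

/-- The collection `Λ = (λ^{(j)})_j`: the `j`-th member consists of the rows of `lam` in the
`j`-th block, in the same order as in `lam`. The blocks are obtained by gluing rows `i` and `l`
for each root `e_i - e_l` in `D`; rows that are not picked form one-row diagrams. -/
def restrictedDiagrams {r : ℕ} (D : Set (PosRoot r)) (lam : Fin (r + 1) → ℤ) (j : Component D) :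
    {i : Fin (r + 1) // Quotient.mk (blocks D) i = j} → ℤ :=
  fun i => lam i.1

/-- Row lengths, indexed from top to bottom, form a Young diagram. -/
def IsYoungDiagram {ι : Type} [LinearOrder ι] (row : ι → ℤ) : Prop :=
  Antitone row ∧ ∀ i, 0 ≤ row i

open scoped Classical in
/-- The irreducible subrepresentation `W` is a copy of the irreducible representation `V_Λ` of
`⊕_j 𝔤_j`: it has a highest-weight vector, killed by the root vectors of all roots in
`∐_j Δ_j⁺`, whose weight on the Cartan subalgebra is given by the rows of `Λ`. -/
def HasHighestWeight {r k L : ℕ} (D : Set (PosRoot r)) (W : Submodule ℂ (Chain r k L))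
    (Lam : (j : Component D) → {i : Fin (r + 1) // Quotient.mk (blocks D) i = j} → ℤ) : Prop :=
  ∃ v ∈ W, v ≠ 0 ∧
    (∀ j, ∀ α ∈ componentRoots D j, chainAct k L (Matrix.single α.1.1 α.1.2 1) v = 0) ∧
    ∀ A ∈ unbroken D, A.IsDiag →
      chainAct k L A v = (∑ j, ∑ i, A i.1 i.1 * (Lam j i : ℂ)) • v

/-- The number of summands of the family `W` that are copies of `V_Λ`. -/
def multiplicity {r k L m : ℕ} (D : Set (PosRoot r)) (W : Fin m → Submodule ℂ (Chain r k L))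
    (Lam : (j : Component D) → {i : Fin (r + 1) // Quotient.mk (blocks D) i = j} → ℤ) : ℕ :=
  Nat.card {i : Fin m // HasHighestWeight D (W i) Lam}

/-! ### Restricted-occupancy coefficients -/

/-- The determinant `det (x_j ^ (λ_i + n - i))`, `1 ≤ i, j ≤ n`. -/
def alternant {n : ℕ} (lam : Fin n → ℕ) : MvPolynomial (Fin n) ℤ :=
  Matrix.det (Matrix.of fun i j : Fin n =>
    (MvPolynomial.X j : MvPolynomial (Fin n) ℤ) ^ (lam i + (Fin.rev i : ℕ)))

/-- The Schur polynomial, the quotient `det (x_j ^ (λ_i + n - i)) / det (x_j ^ (n - i))`, i.e. the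
unique polynomial whose product with the denominator is the numerator. -/
def schur {n : ℕ} (lam : Fin n → ℕ) : MvPolynomial (Fin n) ℤ :=
  Classical.epsilon fun S => S * alternant (fun _ : Fin n => 0) = alternant lam

/-- The generating function `[S_{(k)}(1, x_1, x_1 x_2, …, x_1 ⋯ x_r)]^L`. -/
def genFun (r k L : ℕ) : MvPolynomial (Fin r) ℤ :=
  (MvPolynomial.aeval
    (fun i : Fin (r + 1) => ∏ a : Fin r with a.castSucc < i,
      (MvPolynomial.X a : MvPolynomial (Fin r) ℤ))
    (schur (Pi.single (0 : Fin (r + 1)) k))) ^ L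

/-- `c_{s,L}(M)`, `k = 2s`: the coefficient of `x_1^{M_1} ⋯ x_r^{M_r}` in the generating function;
it is `0` if some `M_a` is negative. -/
def occupancy (r k L : ℕ) (M : Fin r → ℤ) : ℤ :=
  if ∀ a, 0 ≤ M a then
    (genFun r k L).coeff (Finsupp.equivFunOnFinite.symm fun a => (M a).toNat)
  else 0

/-! ### Characters and shift operators -/

/-- `t^α = t_i t_{i+1} ⋯ t_{l-1}` for the root `α = e_i - e_l = α_i + ⋯ + α_{l-1}`. -/
def rootMonomial {r : ℕ} (α : PosRoot r) : MvPolynomial (Fin r) ℤ :=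
  ∏ a : Fin r with α.1.1 ≤ a.castSucc ∧ a.castSucc < α.1.2, MvPolynomial.X a

open scoped Classical in
/-- The reciprocal `χ(𝔤_j)⁻¹ = ∏_{α ∈ Δ_j⁺} (1 - t^α)` of the Verma-module character. -/
def charInv {r : ℕ} (D : Set (PosRoot r)) (j : Component D) : MvPolynomial (Fin r) ℤ :=
  ∏ α : PosRoot r with α ∈ componentRoots D j, (1 - rootMonomial α)

/-- The shift operator `(𝒟_P f)(M) = ∑_{t^β ∈ P} sgn(β) f(M - β)`, where `sgn(β)` is the sign in
front of `t^β` in `P`. -/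
def shift {r : ℕ} (P : MvPolynomial (Fin r) ℤ) (f : (Fin r → ℤ) → ℤ) (M : Fin r → ℤ) : ℤ :=
  ∑ β ∈ P.support, Int.sign (P.coeff β) * f (fun a => M a - (β a : ℤ))

end

end PartialTwist

namespace PartialTwist

noncomputable section

open MvPolynomial

open scoped Classical in
lemma det_card_gt_vandermonde {α R : Type*} [Fintype α] [LinearOrder α] [CommRing R]
    (x : α → R) :
    (Matrix.of fun i j : α => x j ^ (Finset.univ.filter fun l => i < l).card).det =
      ∏ p : α × α with p.1 < p.2, (x p.1 - x p.2) := by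
  obtain ⟨e⟩ : Nonempty (Fin (Fintype.card α) ≃o αᵒᵈ) :=
    ⟨Fintype.orderIsoFinOfCardEq αᵒᵈ (Fintype.card_congr OrderDual.ofDual)⟩
  let f : Fin (Fintype.card α) ≃ α := e.toEquiv.trans OrderDual.ofDual
  have hf : ∀ p q, f p < f q ↔ q < p := fun p q => e.lt_iff_lt (x := q) (y := p)
  have hrank : ∀ p, (Finset.univ.filter fun l => f p < l).card = (p : ℕ) := by
    intro p
    rw [← Fin.card_Iio p]
    refine Finset.card_bij (fun l _ => f.symm l) ?_ ?_ ?_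
    · intro l hl
      simp only [Finset.mem_filter, Finset.mem_univ, true_and] at hl
      rw [← f.apply_symm_apply l, hf] at hl
      simpa using hl
    · intro a _ b _ h
      exact f.symm.injective h
    · intro q hq
      exact ⟨f q, by simpa [hf] using hq, by simp⟩
  rw [← Matrix.det_submatrix_equiv_self f]
  have : (Matrix.of fun i j : α => x j ^ (Finset.univ.filter fun l => i < l).card).submatrix f f =
      (Matrix.vandermonde fun p => x (f p)).transpose := by
    ext p q
    simp only [Matrix.submatrix_apply, Matrix.of_apply, Matrix.transpose_apply,
      Matrix.vandermonde_apply, hrank]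
  rw [this, Matrix.det_transpose, Matrix.det_vandermonde, Finset.prod_sigma']
  refine Finset.prod_bij (fun s _ => (f s.2, f s.1)) ?_ ?_ ?_ ?_
  · intro s hs
    simpa [hf] using hs
  · rintro ⟨a, b⟩ _ ⟨c, d⟩ _ h
    simp only [Prod.mk.injEq, EmbeddingLike.apply_eq_iff_eq] at h
    obtain ⟨rfl, rfl⟩ := h
    rfl
  · rintro ⟨i, l⟩ hil
    refine ⟨⟨f.symm l, f.symm i⟩, ?_, by simp⟩
    simp only [Finset.mem_filter, Finset.mem_univ, true_and] at hil
    rw [← f.apply_symm_apply l, ← f.apply_symm_apply i, hf] at hil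
    simpa using hil
  · intro s _
    rfl

variable {N : ℕ} (P : Setoid (Fin N))

open scoped Classical in
/-- The pairs `i < l` in a common block of `P`. -/
def blockPairs : Finset (Fin N × Fin N) :=
  Finset.univ.filter fun p => p.1 < p.2 ∧ P p.1 p.2

lemma mem_blockPairs {p : Fin N × Fin N} : p ∈ blockPairs P ↔ p.1 < p.2 ∧ P p.1 p.2 := by
  simp [blockPairs]

open scoped Classical in
/-- The number of later members of the block of `i`. -/
def blockRank (i : Fin N) : ℕ :=
  (Finset.univ.filter fun l => i < l ∧ P i l).card

/-- The product of the differences `x_i - x_l` over the pairs `i < l` in a common block. -/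
def blockVandermonde (R : Type*) [CommRing R] : MvPolynomial (Fin N) R :=
  ∏ p ∈ blockPairs P, (X p.1 - X p.2)

lemma blockRank_lt {i l : Fin N} (h : i < l) (hP : P i l) : blockRank P l < blockRank P i := by
  classical
  refine Finset.card_lt_card ⟨?_, ?_⟩
  · intro m hm
    simp only [Finset.mem_filter, Finset.mem_univ, true_and] at hm ⊢
    exact ⟨h.trans hm.1, P.trans' hP hm.2⟩
  · intro hs
    have := @hs l (by simp [h, hP])
    simp at this

lemma blockRank_injOn {i l : Fin N} (hP : P i l) (h : blockRank P i = blockRank P l) : i = l := by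
  rcases lt_trichotomy i l with h1 | h1 | h1
  · exact absurd h (blockRank_lt P h1 hP).ne'
  · exact h1
  · exact absurd h (blockRank_lt P h1 (P.symm' hP)).ne

open scoped Classical in
lemma det_blockVandermonde (R : Type*) [CommRing R] :
    (Matrix.of fun i j : Fin N =>
      if P i j then (X j : MvPolynomial (Fin N) R) ^ blockRank P i else 0).det =
      blockVandermonde P R := by
  let b : Fin N → Fin N := fun i => (Quotient.mk P i).out
  have hb : ∀ i j, b i = b j ↔ P i j := by
    intro i j
    simp only [b, Quotient.out_inj]
    exact Quotient.eq
  have htri : (Matrix.of fun i j : Fin N =>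
      if P i j then (X j : MvPolynomial (Fin N) R) ^ blockRank P i else 0).BlockTriangular b := by
    intro i j hij
    rw [Matrix.of_apply, if_neg]
    intro h
    exact hij.ne ((hb i j).2 h).symm
  rw [htri.det_fintype]
  have hblock : ∀ a : Fin N, ((Matrix.of fun i j : Fin N =>
      if P i j then (X j : MvPolynomial (Fin N) R) ^ blockRank P i else 0).toSquareBlock b a).det
      = ∏ p ∈ blockPairs P with b p.1 = a, (X p.1 - X p.2) := by
    intro a
    have h1 : (Matrix.of fun i j : Fin N =>
        if P i j then (X j : MvPolynomial (Fin N) R) ^ blockRank P i else 0).toSquareBlock b a =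
        Matrix.of fun i j : {i // b i = a} => (X j.1 : MvPolynomial (Fin N) R) ^
          (Finset.univ.filter fun l => i < l).card := by
      ext1 i j
      have hP : P i.1 j.1 := (hb _ _).1 (i.2.trans j.2.symm)
      rw [Matrix.toSquareBlock_def, Matrix.of_apply, Matrix.of_apply, Matrix.of_apply, if_pos hP]
      congr 1
      refine (Finset.card_bij (fun l _ => l.1) ?_ ?_ ?_).symm
      · intro l hl
        simp only [Finset.mem_filter, Finset.mem_univ, true_and] at hl ⊢
        exact ⟨hl, (hb _ _).1 (i.2.trans l.2.symm)⟩
      · intro l _ m _ h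
        exact Subtype.ext h
      · intro l hl
        simp only [Finset.mem_filter, Finset.mem_univ, true_and] at hl
        exact ⟨⟨l, ((hb _ _).2 hl.2).symm.trans i.2⟩, Finset.mem_filter.2 ⟨Finset.mem_univ _, hl.1⟩, rfl⟩
    have h2 := det_card_gt_vandermonde fun j : {i // b i = a} => (X j.1 : MvPolynomial (Fin N) R)
    rw [h1]
    refine (Eq.trans (by congr!) h2).trans ?_
    refine Finset.prod_bij (fun p _ => (p.1.1, p.2.1)) ?_ ?_ ?_ ?_
    · intro p hp
      simp only [Finset.mem_filter, Finset.mem_univ, true_and, mem_blockPairs] at hp ⊢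
      exact ⟨⟨hp, (hb _ _).1 (p.1.2.trans p.2.2.symm)⟩, p.1.2⟩
    · rintro ⟨p, q⟩ _ ⟨p', q'⟩ _ h
      simp only [Prod.mk.injEq] at h
      exact Prod.ext (Subtype.ext h.1) (Subtype.ext h.2)
    · rintro ⟨i, l⟩ hil
      simp only [Finset.mem_filter, mem_blockPairs] at hil
      exact ⟨(⟨i, hil.2⟩, ⟨l, ((hb _ _).2 hil.1.2).symm.trans hil.2⟩),
        Finset.mem_filter.2 ⟨Finset.mem_univ _, hil.1.1⟩, rfl⟩
    · intro p _
      rfl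
  rw [Finset.prod_congr rfl fun a _ => hblock a, blockVandermonde,
    Finset.prod_fiberwise]

/-- The exponent of `∏ x_i ^ blockRank (σ i)`. -/
def rankExponent (σ : Equiv.Perm (Fin N)) : Fin N →₀ ℕ :=
  Finsupp.equivFunOnFinite.symm fun i => blockRank P (σ i)

open scoped Classical in
lemma blockVandermonde_eq_sum (R : Type*) [CommRing R] :
    blockVandermonde P R = ∑ σ : Equiv.Perm (Fin N) with ∀ i, P (σ i) i,
      monomial (rankExponent P σ) ((Equiv.Perm.sign σ : ℤ) : R) := by
  rw [← det_blockVandermonde, Matrix.det_apply', Finset.sum_filter]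
  refine Finset.sum_congr rfl fun σ _ => ?_
  simp only [Matrix.of_apply]
  split_ifs with h
  · rw [Finset.prod_congr rfl fun i _ => if_pos (h i)]
    rw [MvPolynomial.monomial_eq, Finsupp.prod_fintype _ _ (by simp)]
    simp [rankExponent]
  · push Not at h
    obtain ⟨i, hi⟩ := h
    rw [Finset.prod_eq_zero (Finset.mem_univ i) (if_neg hi), mul_zero]

lemma sign_coeff_blockVandermonde (d : Fin N →₀ ℕ) :
    Int.sign ((blockVandermonde P ℤ).coeff d) = (blockVandermonde P ℤ).coeff d := by
  classical
  rw [blockVandermonde_eq_sum, coeff_sum]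
  simp only [coeff_monomial]
  rw [← Finset.sum_filter]
  have hsub : (Finset.filter (fun σ => rankExponent P σ = d)
      (Finset.univ.filter fun σ : Equiv.Perm (Fin N) => ∀ i, P (σ i) i)).card ≤ 1 := by
    rw [Finset.card_le_one]
    intro σ hσ τ hτ
    simp only [Finset.mem_filter, Finset.mem_univ, true_and] at hσ hτ
    refine Equiv.ext fun i => blockRank_injOn P (P.trans' (hσ.1 i) (P.symm' (hτ.1 i))) ?_
    exact DFunLike.congr_fun (hσ.2.trans hτ.2.symm) i
  rcases Finset.card_le_one_iff_subset_singleton.1 hsub with ⟨σ, hσ⟩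
  rcases Finset.subset_singleton_iff.1 hσ with h | h
  · simp [h]
  · rw [h, Finset.sum_singleton]
    rcases Int.units_eq_one_or (Equiv.Perm.sign σ) with h | h <;> simp [h]

lemma sum_sq_of_coeff_blockVandermonde_ne_zero {R : Type*} [CommRing R] {d : Fin N →₀ ℕ}
    (hd : (blockVandermonde P R).coeff d ≠ 0) :
    ∑ i, d i ^ 2 = ∑ i, blockRank P i ^ 2 := by
  classical
  rw [blockVandermonde_eq_sum, coeff_sum] at hd
  obtain ⟨σ, -, hσ⟩ := Finset.exists_ne_zero_of_sum_ne_zero hd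
  rw [coeff_monomial] at hσ
  have : rankExponent P σ = d := by
    by_contra h
    exact hσ (if_neg h)
  rw [← this]
  exact Equiv.sum_comp σ fun i => blockRank P i ^ 2

/-- The Euler derivation `x_i ∂/∂x_i`. -/
def eulerDer (R : Type*) [CommRing R] (i : Fin N) :
    Derivation R (MvPolynomial (Fin N) R) (MvPolynomial (Fin N) R) :=
  (X i : MvPolynomial (Fin N) R) • pderiv i

lemma eulerDer_monomial {R : Type*} [CommRing R] (i : Fin N) (d : Fin N →₀ ℕ) (a : R) :
    eulerDer R i (monomial d a) = (d i : R) • monomial d a := by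
  rw [eulerDer, Derivation.smul_apply, pderiv_monomial, smul_eq_mul, X, monomial_mul,
    smul_monomial, smul_eq_mul, one_mul, mul_comm]
  rcases Nat.eq_zero_or_pos (d i) with h | h
  · simp [h]
  · have hd : Finsupp.single i 1 + (d - Finsupp.single i 1) = d :=
      add_tsub_cancel_of_le (by simpa [Finsupp.single_le_iff] using Nat.succ_le_of_lt h)
    rw [hd]

lemma coeff_eulerDer {R : Type*} [CommRing R] (i : Fin N) (d : Fin N →₀ ℕ)
    (f : MvPolynomial (Fin N) R) : (eulerDer R i f).coeff d = (d i : R) * f.coeff d := by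
  induction f using MvPolynomial.induction_on' with
  | monomial e a =>
    rw [eulerDer_monomial, coeff_smul, coeff_monomial]
    split_ifs with h
    · rw [h, smul_eq_mul]
    · simp
  | add p q hp hq => rw [map_add, coeff_add, hp, hq, coeff_add, mul_add]

lemma eulerDer_X {R : Type*} [CommRing R] (i j : Fin N) :
    eulerDer R i (X j) = if i = j then (X j : MvPolynomial (Fin N) R) else 0 := by
  rw [eulerDer, Derivation.smul_apply, pderiv_X, smul_eq_mul]
  rcases eq_or_ne i j with rfl | h
  · simp
  · simp [h]

/-- The Laplacian `∑ (x_i ∂/∂x_i)²`. -/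
def laplacian (R : Type*) [CommRing R] (f : MvPolynomial (Fin N) R) : MvPolynomial (Fin N) R :=
  ∑ i, eulerDer R i (eulerDer R i f)

lemma coeff_laplacian {R : Type*} [CommRing R] (d : Fin N →₀ ℕ) (f : MvPolynomial (Fin N) R) :
    (laplacian R f).coeff d = (∑ i, (d i : R) ^ 2) * f.coeff d := by
  rw [laplacian, coeff_sum, Finset.sum_mul]
  refine Finset.sum_congr rfl fun i _ => ?_
  rw [coeff_eulerDer, coeff_eulerDer]
  ring

lemma laplacian_blockVandermonde (R : Type*) [CommRing R] :
    laplacian R (blockVandermonde P R) =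
      C (∑ i, (blockRank P i : R) ^ 2) * blockVandermonde P R := by
  ext d
  rw [coeff_laplacian, coeff_C_mul]
  by_cases h : (blockVandermonde P R).coeff d = 0
  · rw [h, mul_zero, mul_zero]
  · have := congrArg (Nat.cast : ℕ → R) (sum_sq_of_coeff_blockVandermonde_ne_zero P h)
    push_cast at this
    rw [this]

lemma laplacian_mul {R : Type*} [CommRing R] (f g : MvPolynomial (Fin N) R) :
    laplacian R (f * g) = f * laplacian R g + 2 * (∑ i, eulerDer R i f * eulerDer R i g) +
      g * laplacian R f := by
  simp only [laplacian, Derivation.leibniz, map_add, smul_eq_mul, Finset.mul_sum,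
    ← Finset.sum_add_distrib]
  refine Finset.sum_congr rfl fun i _ => ?_
  ring

lemma derivation_prod {R A ι : Type*} [DecidableEq ι] [CommRing R] [CommRing A] [Algebra R A]
    (D : Derivation R A A) (s : Finset ι) (g : ι → A) :
    D (∏ p ∈ s, g p) = ∑ p ∈ s, (∏ q ∈ s.erase p, g q) * D (g p) := by
  induction s using Finset.induction_on with
  | empty => simp
  | insert a s ha ih =>
    rw [Finset.prod_insert ha, Derivation.leibniz, ih, Finset.sum_insert ha,
      Finset.erase_insert ha, smul_eq_mul, smul_eq_mul, add_comm, Finset.mul_sum]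
    congr 1
    refine Finset.sum_congr rfl fun p hp => ?_
    have hpa : p ≠ a := fun h => ha (h ▸ hp)
    rw [Finset.erase_insert_of_ne hpa.symm, Finset.prod_insert (by simp [ha]), mul_assoc]

lemma sum_eulerDer_blockVandermonde_mul {R : Type*} [CommRing R] (f : MvPolynomial (Fin N) R) :
    ∑ i, eulerDer R i (blockVandermonde P R) * eulerDer R i f =
      ∑ p ∈ blockPairs P, (∏ q ∈ (blockPairs P).erase p, (X q.1 - X q.2)) *
        (X p.1 * eulerDer R p.1 f - X p.2 * eulerDer R p.2 f) := by
  classical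
  simp only [blockVandermonde, derivation_prod, Finset.sum_mul]
  rw [Finset.sum_comm]
  refine Finset.sum_congr rfl fun p _ => ?_
  simp only [mul_assoc, ← Finset.mul_sum, map_sub, eulerDer_X, sub_mul, ite_mul, zero_mul,
    Finset.sum_sub_distrib, Finset.sum_ite_eq', Finset.mem_univ, if_true]

/-- If `f` satisfies Freudenthal's recursion for a system of positive roots, then its product with
the denominator is an eigenfunction of the Laplacian. -/
lemma laplacian_blockVandermonde_mul {R : Type*} [CommRing R] (f : MvPolynomial (Fin N) R)
    (G : Fin N × Fin N → MvPolynomial (Fin N) R) (c κ : R)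
    (hG : ∀ p ∈ blockPairs P,
      (X p.1 - X p.2) * G p = X p.2 * (eulerDer R p.1 f - eulerDer R p.2 f))
    (hc : C c * f = laplacian R f +
      ∑ p ∈ blockPairs P, (eulerDer R p.1 f - eulerDer R p.2 f + 2 * G p))
    (hκ : C κ * f = ∑ p ∈ blockPairs P, (eulerDer R p.1 f + eulerDer R p.2 f)) :
    laplacian R (blockVandermonde P R * f) =
      C (c + κ + ∑ i, (blockRank P i : R) ^ 2) * (blockVandermonde P R * f) := by
  rw [laplacian_mul, laplacian_blockVandermonde, sum_eulerDer_blockVandermonde_mul, map_add, map_add]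
  have hlap := eq_sub_of_add_eq hc.symm
  have key : blockVandermonde P R * (∑ p ∈ blockPairs P, (eulerDer R p.1 f + eulerDer R p.2 f)) +
      blockVandermonde P R *
        ∑ p ∈ blockPairs P, (eulerDer R p.1 f - eulerDer R p.2 f + 2 * G p) =
      2 * ∑ p ∈ blockPairs P, (∏ q ∈ (blockPairs P).erase p, (X q.1 - X q.2)) *
        (X p.1 * eulerDer R p.1 f - X p.2 * eulerDer R p.2 f) := by
    rw [Finset.mul_sum, Finset.mul_sum, Finset.mul_sum, ← Finset.sum_add_distrib]
    refine Finset.sum_congr rfl fun p hp => ?_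
    rw [blockVandermonde, ← Finset.mul_prod_erase _ _ hp]
    linear_combination 2 * (∏ q ∈ (blockPairs P).erase p, (X q.1 - X q.2)) * hG p hp
  rw [hlap]
  linear_combination -key - blockVandermonde P R * hκ

lemma sum_sq_eq_of_coeff_ne_zero {f : MvPolynomial (Fin N) ℂ} {a : ℂ}
    (h : laplacian ℂ f = C a * f) {d : Fin N →₀ ℕ} (hd : f.coeff d ≠ 0) :
    ∑ i, (d i : ℂ) ^ 2 = a := by
  have := congrArg (coeff d) h
  rw [coeff_laplacian, coeff_C_mul] at this
  exact mul_right_cancel₀ hd this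

end

end PartialTwist

namespace PartialTwist

noncomputable section

open MvPolynomial

variable {N : ℕ} (P : Setoid (Fin N))

/-! ### Roots and the cone they span -/

/-- The root `e_i - e_l` as a vector. -/
def rootVec (p : Fin N × Fin N) : Fin N → ℤ := Pi.single p.1 1 - Pi.single p.2 1

/-- The cone of non-negative combinations of the positive roots within the blocks. -/
def rootCone : AddSubmonoid (Fin N → ℤ) :=
  AddSubmonoid.closure (rootVec '' (blockPairs P : Set (Fin N × Fin N)))

variable {P}

lemma rootVec_mem_rootCone {p : Fin N × Fin N} (hp : p ∈ blockPairs P) :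
    rootVec p ∈ rootCone P :=
  AddSubmonoid.subset_closure ⟨p, hp, rfl⟩

lemma sum_mul_rootVec (x : Fin N → ℤ) (p : Fin N × Fin N) :
    ∑ i, x i * rootVec p i = x p.1 - x p.2 := by
  simp [rootVec, mul_sub, Finset.sum_sub_distrib, Pi.single_apply]

lemma eq_zero_or_pos_of_mem_rootCone {x : Fin N → ℤ}
    (hx : ∀ p ∈ blockPairs P, x p.2 < x p.1) {δ : Fin N → ℤ} (hδ : δ ∈ rootCone P) :
    δ = 0 ∨ 0 < ∑ i, x i * δ i := by
  induction hδ using AddSubmonoid.closure_induction with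
  | mem δ h =>
    obtain ⟨p, hp, rfl⟩ := h
    right
    rw [sum_mul_rootVec]
    exact sub_pos.2 (hx p hp)
  | zero => exact Or.inl rfl
  | add a b _ _ ha hb =>
    rcases ha with rfl | ha
    · rwa [zero_add]
    · rcases hb with rfl | hb
      · rw [add_zero]; exact Or.inr ha
      · right
        simp only [Pi.add_apply, mul_add, Finset.sum_add_distrib]
        exact add_pos ha hb

/-- A functional that is positive on the positive roots. -/
def height (δ : Fin N → ℤ) : ℤ := ∑ i : Fin N, -(i : ℤ) * δ i

lemma height_add (a b : Fin N → ℤ) : height (a + b) = height a + height b := by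
  simp [height, mul_add, Finset.sum_add_distrib]

lemma height_rootVec_pos {p : Fin N × Fin N} (hp : p ∈ blockPairs P) : 0 < height (rootVec p) := by
  rw [height, sum_mul_rootVec]
  have : (p.1 : ℕ) < p.2 := ((mem_blockPairs P).1 hp).1
  omega

lemma eq_zero_or_height_pos {δ : Fin N → ℤ} (hδ : δ ∈ rootCone P) : δ = 0 ∨ 0 < height δ := by
  refine eq_zero_or_pos_of_mem_rootCone (x := fun i => -(i : ℤ)) (fun p hp => ?_) hδ
  have : (p.1 : ℕ) < p.2 := ((mem_blockPairs P).1 hp).1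
  simpa using this

lemma height_nonneg {δ : Fin N → ℤ} (hδ : δ ∈ rootCone P) : 0 ≤ height δ := by
  rcases eq_zero_or_height_pos hδ with rfl | h
  · simp [height]
  · exact h.le

open scoped Classical in
lemma sum_block (P : Setoid (Fin N)) {A : Type*} [AddCommMonoid A] (g : Fin N → Fin N → A) :
    ∑ i, ∑ l, (if P i l then g i l else 0) =
      ∑ i, g i i + ∑ p ∈ blockPairs P, (g p.1 p.2 + g p.2 p.1) := by
  have h1 : ∀ i l, (if P i l then g i l else 0) = (if i = l then g i l else 0) +
      ((if i < l ∧ P i l then g i l else 0) + (if l < i ∧ P l i then g i l else 0)) := by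
    intro i l
    have hs : P i l ↔ P l i := ⟨P.symm', P.symm'⟩
    rcases lt_trichotomy i l with h | rfl | h
    · simp [h, h.ne, h.not_gt]
    · simp
    · simp [h, h.ne', h.not_gt, hs]
  simp only [h1, Finset.sum_add_distrib, Finset.sum_ite_eq, Finset.mem_univ, if_true]
  congr 1
  rw [blockPairs, Finset.sum_filter, Finset.sum_filter, Fintype.sum_prod_type,
    Fintype.sum_prod_type]
  congr 1
  exact Finset.sum_comm

lemma sum_blockPairs_fst (P : Setoid (Fin N)) {A : Type*} [AddCommMonoid A] (g : Fin N → A) :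
    ∑ p ∈ blockPairs P, g p.1 = ∑ i, blockRank P i • g i := by
  classical
  rw [blockPairs, Finset.sum_filter, Fintype.sum_prod_type]
  refine Finset.sum_congr rfl fun i _ => ?_
  rw [blockRank, ← Finset.sum_const, Finset.sum_filter]

/-! ### Modules with a weight basis and a contravariant form -/

/-- A finite-dimensional representation of `gl_N` with a basis of weight vectors, the weights being
non-negative, that is orthogonal for a contravariant positive definite form. -/
structure UnitaryGlModule (N : ℕ) (ι V : Type*) [Fintype ι] [AddCommGroup V] [Module ℂ V] where
  /-- The action of the matrix units. -/
  e : Fin N → Fin N → Module.End ℂ V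
  comm : ∀ i j k l, e i j * e k l =
    e k l * e i j + ((if j = k then e i l else 0) - if l = i then e k j else 0)
  /-- The basis of weight vectors. -/
  basis : Module.Basis ι ℂ V
  /-- The weights of the basis vectors. -/
  wt : ι → Fin N →₀ ℕ
  e_diag : ∀ i c, e i i (basis c) = (wt c i : ℂ) • basis c
  /-- The square norms of the basis vectors. -/
  normSq : ι → ℝ
  normSq_pos : ∀ c, 0 < normSq c
  adj : ∀ i l c c', (normSq c' : ℂ) * starRingEnd ℂ (basis.repr (e i l (basis c)) c') =
    normSq c * basis.repr (e l i (basis c')) c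

namespace UnitaryGlModule

variable {ι V : Type*} [Fintype ι] [AddCommGroup V] [Module ℂ V] (U : UnitaryGlModule N ι V)

lemma comm_apply (i j k l : Fin N) (u : V) : U.e i j (U.e k l u) =
    U.e k l (U.e i j u) + ((if j = k then U.e i l u else 0) - if l = i then U.e k j u else 0) := by
  have := LinearMap.congr_fun (U.comm i j k l) u
  simp only [Module.End.mul_apply, LinearMap.add_apply, LinearMap.sub_apply] at this
  rw [this]
  split_ifs <;> simp

/-- The weight of a basis vector as an integral vector. -/
def wtInt (c : ι) : Fin N → ℤ := fun i => U.wt c i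

/-- `v` is a weight vector. -/
def HasWeight (μ : Fin N → ℤ) (v : V) : Prop := ∀ i, U.e i i v = (μ i : ℂ) • v

variable (P) in
/-- `v` is a highest-weight vector for the block-diagonal subalgebra. -/
def IsHighest (μ : Fin N → ℤ) (v : V) : Prop :=
  v ≠ 0 ∧ (∀ i l, i < l → P i l → U.e i l v = 0) ∧ U.HasWeight μ v

variable (P) in
/-- `W` is invariant under the block-diagonal subalgebra. -/
def Invariant (W : Submodule ℂ V) : Prop := ∀ i l, P i l → ∀ v ∈ W, U.e i l v ∈ W

variable (P) in
/-- `W` is irreducible for the block-diagonal subalgebra. -/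
def Irreducible (W : Submodule ℂ V) : Prop :=
  U.Invariant P W ∧ W ≠ ⊥ ∧ ∀ W' : Submodule ℂ V, U.Invariant P W' → W' ≤ W → W' = ⊥ ∨ W' = W

lemma hasWeight_basis (c : ι) : U.HasWeight (U.wtInt c) (U.basis c) := fun i => by
  rw [U.e_diag]
  simp [wtInt]

lemma repr_e_diag (i : Fin N) (u : V) (c : ι) :
    U.basis.repr (U.e i i u) c = (U.wt c i : ℂ) * U.basis.repr u c := by
  classical
  conv_lhs => rw [← U.basis.sum_repr u]
  simp only [map_sum, map_smul, U.e_diag, Finsupp.coe_finsetSum, Finset.sum_apply,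
    Finsupp.smul_apply, Module.Basis.repr_self, smul_eq_mul, Finsupp.single_apply, mul_ite, mul_one,
    mul_zero, Finset.sum_ite_eq', Finset.mem_univ, if_true]
  ring

lemma repr_apply (T : Module.End ℂ V) (u : V) (c : ι) :
    U.basis.repr (T u) c = ∑ c', U.basis.repr u c' * U.basis.repr (T (U.basis c')) c := by
  conv_lhs => rw [← U.basis.sum_repr u]
  simp only [map_sum, map_smul, Finsupp.coe_finsetSum, Finset.sum_apply, Finsupp.smul_apply,
    smul_eq_mul]

variable {U}

lemma HasWeight.wtInt_eq {μ : Fin N → ℤ} {v : V} (h : U.HasWeight μ v) {c : ι}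
    (hc : U.basis.repr v c ≠ 0) : U.wtInt c = μ := by
  funext i
  have := congrArg (fun w => U.basis.repr w c) (h i)
  simp only [repr_e_diag, map_smul, Finsupp.smul_apply, smul_eq_mul] at this
  have h2 := mul_right_cancel₀ hc this
  simp only [wtInt]
  exact_mod_cast h2

lemma HasWeight.e {μ : Fin N → ℤ} {v : V} (h : U.HasWeight μ v) (i l : Fin N) :
    U.HasWeight (μ + rootVec (i, l)) (U.e i l v) := by
  intro j
  rw [comm_apply, h j, map_smul]
  simp only [Pi.add_apply, rootVec, Pi.sub_apply, Pi.single_apply]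
  by_cases h1 : j = i <;> by_cases h2 : j = l <;>
    simp [h1, h2, eq_comm, add_smul, sub_smul] <;> simp_all [eq_comm]

lemma wtInt_eq_of_repr_e_ne_zero {i l : Fin N} {c c' : ι}
    (h : U.basis.repr (U.e i l (U.basis c)) c' ≠ 0) :
    U.wtInt c' = U.wtInt c + rootVec (i, l) :=
  ((U.hasWeight_basis c).e i l).wtInt_eq h

open scoped Classical in
variable (U) in
/-- The projection to a weight space. -/
def weightProj (ν : Fin N → ℤ) : V →ₗ[ℂ] V :=
  U.basis.constr ℂ fun c => if U.wtInt c = ν then U.basis c else 0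

lemma HasWeight.weightProj_self {ν : Fin N → ℤ} {v : V} (h : U.HasWeight ν v) :
    U.weightProj ν v = v := by
  conv_rhs => rw [← U.basis.sum_repr v]
  rw [weightProj, Module.Basis.constr_apply_fintype]
  refine Finset.sum_congr rfl fun c _ => ?_
  rw [Module.Basis.equivFun_apply]
  by_cases hc : U.basis.repr v c = 0
  · simp [hc]
  · rw [if_pos (h.wtInt_eq hc)]

lemma HasWeight.weightProj_of_ne {μ ν : Fin N → ℤ} {v : V} (h : U.HasWeight μ v) (hne : μ ≠ ν) :
    U.weightProj ν v = 0 := by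
  rw [weightProj, Module.Basis.constr_apply_fintype]
  refine Finset.sum_eq_zero fun c _ => ?_
  rw [Module.Basis.equivFun_apply]
  by_cases hc : U.basis.repr v c = 0
  · simp [hc]
  · rw [if_neg (by rw [h.wtInt_eq hc]; exact hne), smul_zero]

/-! ### The module generated by a highest-weight vector -/

variable (P U) in
/-- The vectors obtained from `v` by applying lowering operators, and their depths. -/
inductive Lowered (v : V) : (Fin N → ℤ) → V → Prop
  | base : Lowered v 0 v
  | step {δ : Fin N → ℤ} {u : V} {i l : Fin N} (hil : (i, l) ∈ blockPairs P) :
      Lowered v δ u → Lowered v (δ + rootVec (i, l)) (U.e l i u)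

lemma Lowered.hasWeight {v : V} {μ : Fin N → ℤ} (hv : U.HasWeight μ v) {δ : Fin N → ℤ} {u : V}
    (h : Lowered P U v δ u) : U.HasWeight (μ - δ) u := by
  induction h with
  | base => rwa [sub_zero]
  | @step δ u i l _ _ ih =>
    have := ih.e l i
    convert this using 1
    simp only [rootVec]
    abel

lemma Lowered.mem_rootCone {v : V} {δ : Fin N → ℤ} {u : V} (h : Lowered P U v δ u) :
    δ ∈ rootCone P := by
  induction h with
  | base => exact zero_mem _
  | step hil _ ih => exact add_mem ih (rootVec_mem_rootCone hil)

lemma Lowered.eq_or_ne_zero {v : V} {δ : Fin N → ℤ} {u : V} (h : Lowered P U v δ u) :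
    u = v ∨ δ ≠ 0 := by
  cases h with
  | base => exact Or.inl rfl
  | step hil h =>
    right
    intro h0
    have h1 := congrArg height h0
    rw [height_add] at h1
    have h2 := height_nonneg h.mem_rootCone
    have h3 := height_rootVec_pos hil
    have h4 : height (0 : Fin N → ℤ) = 0 := by simp [height]
    omega

variable (P U) in
/-- The span of the vectors obtained from `v` by lowering operators. -/
def loweredSpan (v : V) : Submodule ℂ V := Submodule.span ℂ {u | ∃ δ, Lowered P U v δ u}

lemma e_lower_mem_loweredSpan {v w : V} {i l : Fin N} (hil : (i, l) ∈ blockPairs P)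
    (hw : w ∈ U.loweredSpan P v) : U.e l i w ∈ U.loweredSpan P v := by
  induction hw using Submodule.span_induction with
  | mem u hu =>
    obtain ⟨δ, hu⟩ := hu
    exact Submodule.subset_span ⟨_, hu.step hil⟩
  | zero => rw [map_zero]; exact zero_mem _
  | add x y _ _ hx hy => rw [map_add]; exact add_mem hx hy
  | smul a x _ hx => rw [map_smul]; exact Submodule.smul_mem _ _ hx

lemma IsHighest.e_mem_loweredSpan {v : V} {μ : Fin N → ℤ} (hv : U.IsHighest P μ v)
    {δ : Fin N → ℤ} {u : V} (h : Lowered P U v δ u) (p q : Fin N) (hpq : P p q) :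
    U.e p q u ∈ U.loweredSpan P v := by
  induction h generalizing p q with
  | base =>
    have hmem : v ∈ U.loweredSpan P v := Submodule.subset_span ⟨0, Lowered.base⟩
    rcases lt_trichotomy p q with h | rfl | h
    · rw [hv.2.1 p q h hpq]; exact zero_mem _
    · rw [hv.2.2 p]; exact Submodule.smul_mem _ _ hmem
    · exact e_lower_mem_loweredSpan ((mem_blockPairs P).2 ⟨h, P.symm' hpq⟩) hmem
  | @step δ u i l hil _ ih =>
    rw [comm_apply]
    have hP := ((mem_blockPairs P).1 hil).2
    refine add_mem (e_lower_mem_loweredSpan hil (ih p q hpq)) (sub_mem ?_ ?_)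
    · split_ifs with h
      · exact ih p i (P.trans' (h ▸ hpq) (P.symm' hP))
      · exact zero_mem _
    · split_ifs with h
      · exact ih l q (P.trans' (P.symm' hP) (h ▸ hpq))
      · exact zero_mem _

lemma IsHighest.invariant_loweredSpan {v : V} {μ : Fin N → ℤ} (hv : U.IsHighest P μ v) :
    U.Invariant P (U.loweredSpan P v) := by
  intro p q hpq w hw
  induction hw using Submodule.span_induction with
  | mem u hu =>
    obtain ⟨δ, hu⟩ := hu
    exact hv.e_mem_loweredSpan hu p q hpq
  | zero => rw [map_zero]; exact zero_mem _
  | add x y _ _ hx hy => rw [map_add]; exact add_mem hx hy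
  | smul a x _ hx => rw [map_smul]; exact Submodule.smul_mem _ _ hx

lemma loweredSpan_le {W : Submodule ℂ V} (hW : U.Invariant P W) {v : V} (hv : v ∈ W) :
    U.loweredSpan P v ≤ W := by
  refine Submodule.span_le.2 ?_
  rintro u ⟨δ, hu⟩
  induction hu with
  | base => exact hv
  | step hil _ ih => exact hW _ _ (P.symm' ((mem_blockPairs P).1 hil).2) _ ih

lemma Irreducible.eq_loweredSpan {W : Submodule ℂ V} (hW : U.Irreducible P W) {v : V}
    {μ : Fin N → ℤ} (hv : U.IsHighest P μ v) (hvW : v ∈ W) : U.loweredSpan P v = W := by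
  refine (hW.2.2 _ hv.invariant_loweredSpan (loweredSpan_le hW.1 hvW)).resolve_left fun h => ?_
  have : v ∈ U.loweredSpan P v := Submodule.subset_span ⟨0, Lowered.base⟩
  rw [h, Submodule.mem_bot] at this
  exact hv.1 this

lemma Irreducible.weightProj_mem {W : Submodule ℂ V} (hW : U.Irreducible P W) {v : V}
    {μ ν : Fin N → ℤ} (hv : U.IsHighest P μ v) (hvW : v ∈ W) {x : V} (hx : x ∈ W)
    (hxν : U.HasWeight ν x) :
    x ∈ Submodule.span ℂ (U.weightProj ν '' {u | ∃ δ, Lowered P U v δ u}) := by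
  rw [← Submodule.map_span, ← hxν.weightProj_self]
  rw [← hW.eq_loweredSpan hv hvW] at hx
  exact Submodule.mem_map_of_mem hx

lemma Irreducible.sub_mem_rootCone {W : Submodule ℂ V} (hW : U.Irreducible P W) {v : V}
    {μ ν : Fin N → ℤ} (hv : U.IsHighest P μ v) (hvW : v ∈ W) {x : V} (hx : x ∈ W)
    (hxν : U.HasWeight ν x) (hx0 : x ≠ 0) : μ - ν ∈ rootCone P := by
  have hmem := hW.weightProj_mem hv hvW hx hxν
  by_contra hcone
  have : Submodule.span ℂ (U.weightProj ν '' {u | ∃ δ, Lowered P U v δ u}) ≤ ⊥ := by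
    refine Submodule.span_le.2 ?_
    rintro _ ⟨u, ⟨δ, hu⟩, rfl⟩
    refine (hu.hasWeight hv.2.2).weightProj_of_ne fun h => hcone ?_
    rw [← h, sub_sub_cancel]
    exact hu.mem_rootCone
  exact hx0 ((Submodule.mem_bot ℂ).1 (this hmem))

lemma Irreducible.mem_span_of_hasWeight {W : Submodule ℂ V} (hW : U.Irreducible P W) {v : V}
    {μ : Fin N → ℤ} (hv : U.IsHighest P μ v) (hvW : v ∈ W) {x : V} (hx : x ∈ W)
    (hxμ : U.HasWeight μ x) : x ∈ Submodule.span ℂ {v} := by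
  refine Submodule.span_le.2 ?_ (hW.weightProj_mem hv hvW hx hxμ)
  rintro _ ⟨u, ⟨δ, hu⟩, rfl⟩
  rcases hu.eq_or_ne_zero with rfl | h
  · rw [hv.2.2.weightProj_self]
    exact Submodule.mem_span_singleton_self _
  · rw [(hu.hasWeight hv.2.2).weightProj_of_ne (by simpa using h)]
    exact zero_mem _

/-! ### Central operators -/

lemma Irreducible.eq_smul_of_commute {W : Submodule ℂ V} (hW : U.Irreducible P W)
    {T : Module.End ℂ V} (hT : ∀ i l, P i l → Commute T (U.e i l)) {v : V} (hv : v ≠ 0)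
    (hvW : v ∈ W) {a : ℂ} (hTv : T v = a • v) {w : V} (hw : w ∈ W) : T w = a • w := by
  let K : Submodule ℂ V := W ⊓ LinearMap.ker (T - a • (1 : Module.End ℂ V))
  have hmem : ∀ x, x ∈ K ↔ x ∈ W ∧ T x = a • x := by
    intro x
    simp [K, sub_eq_zero]
  have hK : U.Invariant P K := by
    intro i l hil x hx
    rw [hmem] at hx ⊢
    refine ⟨hW.1 i l hil x hx.1, ?_⟩
    have := LinearMap.congr_fun (hT i l hil).eq x
    simp only [Module.End.mul_apply] at this
    rw [this, hx.2, map_smul]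
  rcases hW.2.2 K hK inf_le_left with h | h
  · have : v ∈ K := (hmem v).2 ⟨hvW, hTv⟩
    rw [h, Submodule.mem_bot] at this
    exact absurd this hv
  · rw [← h] at hw
    exact ((hmem w).1 hw).2

open scoped Classical in
variable (P U) in
/-- The Casimir operator of the block-diagonal subalgebra. -/
def casimir : Module.End ℂ V := ∑ i, ∑ l, if P i l then U.e i l * U.e l i else 0

variable (P U) in
/-- A central element of the block-diagonal subalgebra: the sum of the `E_{ii} + E_{ll}` over the
pairs `i < l` in a block. -/
def pairSum : Module.End ℂ V := ∑ p ∈ blockPairs P, (U.e p.1 p.1 + U.e p.2 p.2)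

lemma casimir_eq : U.casimir P = ∑ i, U.e i i * U.e i i +
    ∑ p ∈ blockPairs P, (U.e p.1 p.2 * U.e p.2 p.1 + U.e p.2 p.1 * U.e p.1 p.2) := by
  rw [casimir, sum_block P fun i l => U.e i l * U.e l i]

lemma commute_casimir {a b : Fin N} (hab : P a b) : Commute (U.casimir P) (U.e a b) := by
  classical
  have h : ∀ i l, (if P i l then U.e i l * U.e l i else 0) * U.e a b -
      U.e a b * (if P i l then U.e i l * U.e l i else 0) =
      ((if i = a then (if P a l then U.e a l * U.e l b else 0) else 0) -
        (if b = l then (if P i b then U.e i b * U.e a i else 0) else 0)) +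
      ((if l = a then (if P i a then U.e i b * U.e a i else 0) else 0) -
        (if b = i then (if P b l then U.e a l * U.e l b else 0) else 0)) := by
    intro i l
    by_cases hil : P i l
    · have e1 : U.e i l * U.e l i * U.e a b - U.e a b * (U.e i l * U.e l i) =
          U.e i l * (U.e l i * U.e a b - U.e a b * U.e l i) +
          (U.e i l * U.e a b - U.e a b * U.e i l) * U.e l i := by noncomm_ring
      rw [if_pos hil, e1, U.comm l i a b, U.comm i l a b, add_sub_cancel_left,
        add_sub_cancel_left, mul_sub, sub_mul, mul_ite, mul_ite, ite_mul, ite_mul]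
      simp only [mul_zero, zero_mul]
      congr 2
      · split_ifs with h1 h2 <;> [subst h1; subst h1; skip] <;> first | rfl | exact absurd hil h2
      · split_ifs with h1 h2 <;> [subst h1; subst h1; skip] <;> first | rfl | exact absurd hil h2
      · split_ifs with h1 h2 <;> [subst h1; subst h1; skip] <;> first | rfl | exact absurd hil h2
      · split_ifs with h1 h2 <;> [subst h1; subst h1; skip] <;> first | rfl | exact absurd hil h2
    · rw [if_neg hil, zero_mul, mul_zero, sub_zero]
      have h1 : (if i = a then (if P a l then U.e a l * U.e l b else 0) else 0) = 0 := by
        split_ifs with k1 k2 <;> [(subst k1; exact absurd k2 hil); rfl; rfl]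
      have h2 : (if b = l then (if P i b then U.e i b * U.e a i else 0) else 0) = 0 := by
        split_ifs with k1 k2 <;> [(subst k1; exact absurd k2 hil); rfl; rfl]
      have h3 : (if l = a then (if P i a then U.e i b * U.e a i else 0) else 0) = 0 := by
        split_ifs with k1 k2 <;> [(subst k1; exact absurd k2 hil); rfl; rfl]
      have h4 : (if b = i then (if P b l then U.e a l * U.e l b else 0) else 0) = 0 := by
        split_ifs with k1 k2 <;> [(subst k1; exact absurd k2 hil); rfl; rfl]
      rw [h1, h2, h3, h4]
      simp
  rw [Commute, SemiconjBy, ← sub_eq_zero, casimir]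
  simp only [Finset.sum_mul, Finset.mul_sum, ← Finset.sum_sub_distrib, h]
  simp only [Finset.sum_add_distrib, Finset.sum_sub_distrib]
  have s1 : ∀ g : Fin N → Module.End ℂ V,
      ∑ i, ∑ l, (if i = a then g l else 0) = ∑ l, g l := fun g => by
    rw [Finset.sum_comm]; simp
  have s2 : ∀ g : Fin N → Module.End ℂ V,
      ∑ i, ∑ l, (if b = l then g i else 0) = ∑ l, g l := fun g => by simp
  have s3 : ∀ g : Fin N → Module.End ℂ V,
      ∑ i, ∑ l, (if l = a then g i else 0) = ∑ l, g l := fun g => by simp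
  have s4 : ∀ g : Fin N → Module.End ℂ V,
      ∑ i, ∑ l, (if b = i then g l else 0) = ∑ l, g l := fun g => by
    rw [Finset.sum_comm]; simp
  rw [s1 fun l => if P a l then U.e a l * U.e l b else 0,
    s2 fun i => if P i b then U.e i b * U.e a i else 0,
    s3 fun i => if P i a then U.e i b * U.e a i else 0,
    s4 fun l => if P b l then U.e a l * U.e l b else 0]
  have p1 : ∀ i, P i a ↔ P i b := fun i => ⟨fun h => P.trans' h hab, fun h => P.trans' h (P.symm' hab)⟩
  have p2 : ∀ l, P b l ↔ P a l := fun i => ⟨fun h => P.trans' hab h, fun h => P.trans' (P.symm' hab) h⟩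
  simp only [p1, p2]
  abel

lemma commute_pairSum {a b : Fin N} (hab : P a b) : Commute (U.pairSum P) (U.e a b) := by
  classical
  have hsum : U.pairSum P = (∑ i, ∑ l, if P i l then U.e i i else 0) - ∑ i, U.e i i := by
    rw [sum_block P fun i _ => U.e i i, add_sub_cancel_left, pairSum]
  rw [Commute, SemiconjBy, ← sub_eq_zero, hsum]
  have h : ∀ i, U.e i i * U.e a b - U.e a b * U.e i i =
      (if i = a then U.e a b else 0) - if b = i then U.e a b else 0 := by
    intro i
    rw [U.comm i i a b, add_sub_cancel_left]
    congr 1 <;> split_ifs with h <;> simp [h]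
  have h1 : (∑ i, U.e i i) * U.e a b - U.e a b * ∑ i, U.e i i = 0 := by
    rw [Finset.sum_mul, Finset.mul_sum, ← Finset.sum_sub_distrib, Finset.sum_congr rfl fun i _ => h i,
      Finset.sum_sub_distrib]
    simp
  have h2 : (∑ i, ∑ l, if P i l then U.e i i else 0) * U.e a b -
      U.e a b * (∑ i, ∑ l, if P i l then U.e i i else 0) = 0 := by
    have : ∀ i l, (if P i l then U.e i i else 0) * U.e a b -
        U.e a b * (if P i l then U.e i i else 0) =
        (if i = a then (if P a l then U.e a b else 0) else 0) -
        if b = i then (if P b l then U.e a b else 0) else 0 := by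
      intro i l
      split_ifs <;> simp_all
    simp only [Finset.sum_mul, Finset.mul_sum, ← Finset.sum_sub_distrib, this]
    have p2 : ∀ l, P b l ↔ P a l :=
      fun i => ⟨fun h => P.trans' hab h, fun h => P.trans' (P.symm' hab) h⟩
    simp only [p2]
    simp only [Finset.sum_sub_distrib]
    rw [Finset.sum_comm, sub_eq_zero]
    conv_rhs => rw [Finset.sum_comm]
    simp
  rw [sub_mul, mul_sub, sub_sub_sub_comm, h1, h2, sub_zero]

/-! ### Weighted traces -/

variable (U) in
/-- The trace of an operator, weighted by the torus. -/
def wtTrace : Module.End ℂ V →ₗ[ℂ] MvPolynomial (Fin N) ℂ where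
  toFun Y := ∑ c, monomial (U.wt c) (U.basis.repr (Y (U.basis c)) c)
  map_add' Y Z := by simp [Finset.sum_add_distrib]
  map_smul' a Y := by simp [Finset.smul_sum, smul_monomial]

lemma wtTrace_apply (Y : Module.End ℂ V) :
    U.wtTrace Y = ∑ c, monomial (U.wt c) (U.basis.repr (Y (U.basis c)) c) := rfl

lemma wtTrace_e_diag_mul (i : Fin N) (Y : Module.End ℂ V) :
    U.wtTrace (U.e i i * Y) = eulerDer ℂ i (U.wtTrace Y) := by
  simp only [wtTrace_apply, map_sum, eulerDer_monomial, Module.End.mul_apply, repr_e_diag,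
    smul_monomial, smul_eq_mul]

lemma X_mul_wtTrace_e_mul (i l : Fin N) (Y : Module.End ℂ V) :
    X l * U.wtTrace (U.e i l * Y) = X i * U.wtTrace (Y * U.e i l) := by
  simp only [wtTrace_apply, Module.End.mul_apply]
  simp only [U.repr_apply Y (U.e i l _), U.repr_apply (U.e i l) (Y _), Finset.mul_sum, map_sum]
  rw [Finset.sum_comm]
  refine Finset.sum_congr rfl fun c _ => Finset.sum_congr rfl fun c' _ => ?_
  rw [X, X, monomial_mul, monomial_mul, mul_comm (U.basis.repr (Y (U.basis c')) c)]
  by_cases h : U.basis.repr (U.e i l (U.basis c)) c' = 0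
  · simp [h]
  · have hw := wtInt_eq_of_repr_e_ne_zero h
    have : Finsupp.single l 1 + U.wt c' = Finsupp.single i 1 + U.wt c := by
      ext j
      have := congrFun hw j
      simp only [wtInt, Pi.add_apply, rootVec, Pi.sub_apply, Pi.single_apply] at this
      simp only [Finsupp.add_apply, Finsupp.single_apply]
      simp only [eq_comm (a := j)] at this
      split_ifs at this ⊢ <;> omega
    rw [this]

end UnitaryGlModule

end

end PartialTwist

namespace PartialTwist

noncomputable section

open MvPolynomial

variable {N : ℕ} {P : Setoid (Fin N)}

/-- The sum of a set of roots. -/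
def rootSum (S : Finset (Fin N × Fin N)) : Fin N → ℤ := ∑ p ∈ S, rootVec p

lemma rootSum_mem_rootCone {S : Finset (Fin N × Fin N)} (hS : S ⊆ blockPairs P) :
    rootSum S ∈ rootCone P :=
  sum_mem fun _ hp => rootVec_mem_rootCone (hS hp)

lemma rootSum_ne_zero {S : Finset (Fin N × Fin N)} (hS : S ⊆ blockPairs P) (h : S.Nonempty) :
    0 < height (rootSum S) := by
  classical
  obtain ⟨p, hp⟩ := h
  rw [rootSum, ← Finset.add_sum_erase _ _ hp, height_add]
  exact add_pos_of_pos_of_nonneg (height_rootVec_pos (hS hp))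
    (height_nonneg (rootSum_mem_rootCone ((Finset.erase_subset _ _).trans hS)))

variable (P) in
open scoped Classical in
/-- The exponent of the term of the denominator indexed by a set `S` of roots. -/
def denominatorExponent (S : Finset (Fin N × Fin N)) : Fin N →₀ ℕ :=
  ∑ p ∈ S, Finsupp.single p.2 1 + ∑ p ∈ blockPairs P \ S, Finsupp.single p.1 1

lemma denominatorExponent_apply {S : Finset (Fin N × Fin N)} (hS : S ⊆ blockPairs P) (i : Fin N) :
    (denominatorExponent P S i : ℤ) = blockRank P i - rootSum S i := by
  classical
  have h1 : (blockRank P i : ℤ) = ∑ p ∈ blockPairs P, if p.1 = i then 1 else 0 := by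
    rw [sum_blockPairs_fst P fun j => if j = i then (1 : ℤ) else 0]
    simp
  rw [h1, ← Finset.sum_sdiff hS, denominatorExponent, rootSum]
  simp only [Finsupp.add_apply, Finsupp.finsetSum_apply, Finsupp.single_apply, Nat.cast_add,
    Nat.cast_sum, Nat.cast_ite, Nat.cast_one, Nat.cast_zero, Finset.sum_apply, rootVec,
    Pi.sub_apply, Pi.single_apply, Finset.sum_sub_distrib, eq_comm (a := i)]
  ring

lemma blockVandermonde_eq_sum_powerset (R : Type*) [CommRing R] :
    blockVandermonde P R = ∑ S ∈ (blockPairs P).powerset,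
      monomial (denominatorExponent P S) ((-1) ^ S.card : R) := by
  classical
  rw [blockVandermonde]
  simp only [sub_eq_neg_add]
  rw [Finset.prod_add]
  refine Finset.sum_congr rfl fun S _ => ?_
  have h : ∀ (T : Finset (Fin N × Fin N)) (g : Fin N × Fin N → Fin N),
      ∏ p ∈ T, (X (g p) : MvPolynomial (Fin N) R) =
        monomial (∑ p ∈ T, Finsupp.single (g p) 1) 1 := by
    intro T g
    rw [monomial_sum_one]
    rfl
  rw [Finset.prod_neg, h S fun p => p.2, h _ fun p => p.1, mul_assoc, monomial_mul, one_mul,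
    denominatorExponent, ← C_1, ← C_neg, ← C_pow, C_mul_monomial, mul_one]

namespace UnitaryGlModule

variable {ι V : Type*} [Fintype ι] [AddCommGroup V] [Module ℂ V] {U : UnitaryGlModule N ι V}

open scoped Classical in
lemma coeff_blockVandermonde_mul_wtTrace {lam : Fin N → ℤ} {d : Fin N →₀ ℕ}
    (hd : ∀ i, (d i : ℤ) = lam i + blockRank P i) (Y : Module.End ℂ V) :
    (blockVandermonde P ℂ * U.wtTrace Y).coeff d =
      ∑ S ∈ (blockPairs P).powerset, (-1) ^ S.card *
        ∑ c with U.wtInt c = lam + rootSum S, U.basis.repr (Y (U.basis c)) c := by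
  rw [blockVandermonde_eq_sum_powerset, wtTrace_apply, Finset.sum_mul, coeff_sum]
  refine Finset.sum_congr rfl fun S hS => ?_
  rw [Finset.mul_sum, coeff_sum, Finset.mul_sum, Finset.sum_filter]
  refine Finset.sum_congr rfl fun c _ => ?_
  rw [monomial_mul, coeff_monomial]
  have : denominatorExponent P S + U.wt c = d ↔ U.wtInt c = lam + rootSum S := by
    rw [Finsupp.ext_iff, funext_iff]
    refine forall_congr' fun i => ?_
    have h1 := denominatorExponent_apply (Finset.mem_powerset.1 hS) i
    have h2 := hd i
    simp only [Finsupp.add_apply, wtInt, Pi.add_apply]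
    omega
  simp only [this]

lemma HasWeight.of_commute {Q : Module.End ℂ V} (hQ : ∀ i l, P i l → Commute Q (U.e i l))
    {ν : Fin N → ℤ} {x : V} (hx : U.HasWeight ν x) : U.HasWeight ν (Q x) := by
  intro i
  have := LinearMap.congr_fun (hQ i i (P.refl' i)).eq x
  simp only [Module.End.mul_apply] at this
  rw [← this, hx i, map_smul]

lemma IsHighest.pairSum_apply {v : V} {μ : Fin N → ℤ} (hv : U.IsHighest P μ v) :
    U.pairSum P v = (∑ p ∈ blockPairs P, ((μ p.1 : ℂ) + μ p.2)) • v := by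
  simp only [pairSum, LinearMap.sum_apply, LinearMap.add_apply, hv.2.2 _, Finset.sum_smul, add_smul]

lemma IsHighest.e_e_apply {v : V} {μ : Fin N → ℤ} (hv : U.IsHighest P μ v) {p : Fin N × Fin N}
    (hp : p ∈ blockPairs P) : U.e p.1 p.2 (U.e p.2 p.1 v) = ((μ p.1 : ℂ) - μ p.2) • v := by
  obtain ⟨h1, h2⟩ := (mem_blockPairs P).1 hp
  rw [comm_apply, hv.2.1 _ _ h1 h2, map_zero, if_pos rfl, if_pos rfl, hv.2.2, hv.2.2, zero_add,
    sub_smul]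

lemma IsHighest.casimir_apply {v : V} {μ : Fin N → ℤ} (hv : U.IsHighest P μ v) :
    U.casimir P v =
      (∑ i, (μ i : ℂ) ^ 2 + ∑ p ∈ blockPairs P, ((μ p.1 : ℂ) - μ p.2)) • v := by
  rw [casimir_eq]
  simp only [LinearMap.sum_apply, LinearMap.add_apply, Module.End.mul_apply, add_smul,
    Finset.sum_smul]
  congr 1
  · refine Finset.sum_congr rfl fun i _ => ?_
    rw [hv.2.2, map_smul, hv.2.2, smul_smul, sq]
  · refine Finset.sum_congr rfl fun p hp => ?_
    obtain ⟨h1, h2⟩ := (mem_blockPairs P).1 hp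
    rw [hv.e_e_apply hp, hv.2.1 _ _ h1 h2, map_zero, add_zero]

section Projection

variable {W : Submodule ℂ V} {Q : Module.End ℂ V} {v : V} {μ : Fin N → ℤ}

lemma casimir_mul_eq (hW : U.Irreducible P W) (hQW : ∀ x, Q x ∈ W) (hv : U.IsHighest P μ v)
    (hvW : v ∈ W) : U.casimir P * Q =
      (∑ i, (μ i : ℂ) ^ 2 + ∑ p ∈ blockPairs P, ((μ p.1 : ℂ) - μ p.2)) • Q :=
  LinearMap.ext fun x => hW.eq_smul_of_commute (fun _ _ h => commute_casimir h) hv.1 hvW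
    hv.casimir_apply (hQW x)

lemma pairSum_mul_eq (hW : U.Irreducible P W) (hQW : ∀ x, Q x ∈ W) (hv : U.IsHighest P μ v)
    (hvW : v ∈ W) : U.pairSum P * Q = (∑ p ∈ blockPairs P, ((μ p.1 : ℂ) + μ p.2)) • Q :=
  LinearMap.ext fun x => hW.eq_smul_of_commute (fun _ _ h => commute_pairSum h) hv.1 hvW
    hv.pairSum_apply (hQW x)

lemma laplacian_blockVandermonde_mul_wtTrace (hW : U.Irreducible P W) (hQW : ∀ x, Q x ∈ W)
    (hQ : ∀ i l, P i l → Commute Q (U.e i l)) (hv : U.IsHighest P μ v) (hvW : v ∈ W) :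
    laplacian ℂ (blockVandermonde P ℂ * U.wtTrace Q) =
      C (∑ i, ((μ i : ℂ) + blockRank P i) ^ 2) * (blockVandermonde P ℂ * U.wtTrace Q) := by
  have hcomm : ∀ p : Fin N × Fin N, U.wtTrace (U.e p.1 p.2 * (U.e p.2 p.1 * Q)) =
      U.wtTrace (U.e p.2 p.1 * (U.e p.1 p.2 * Q)) +
        (eulerDer ℂ p.1 (U.wtTrace Q) - eulerDer ℂ p.2 (U.wtTrace Q)) := by
    intro p
    rw [← mul_assoc, U.comm, if_pos rfl, if_pos rfl, add_mul, sub_mul, map_add, map_sub,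
      wtTrace_e_diag_mul, wtTrace_e_diag_mul, mul_assoc]
  rw [laplacian_blockVandermonde_mul P (U.wtTrace Q)
    (fun p => U.wtTrace (U.e p.2 p.1 * (U.e p.1 p.2 * Q)))
    (∑ i, (μ i : ℂ) ^ 2 + ∑ p ∈ blockPairs P, ((μ p.1 : ℂ) - μ p.2))
    (∑ p ∈ blockPairs P, ((μ p.1 : ℂ) + μ p.2))]
  · congr 2
    have h1 : ∑ p ∈ blockPairs P, ((μ p.1 : ℂ) - μ p.2) +
        ∑ p ∈ blockPairs P, ((μ p.1 : ℂ) + μ p.2) = ∑ i, (blockRank P i : ℂ) * (2 * μ i) := by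
      have := sum_blockPairs_fst P fun i => (2 : ℂ) * μ i
      simp only [nsmul_eq_mul] at this
      rw [← this, ← Finset.sum_add_distrib]
      exact Finset.sum_congr rfl fun p _ => by ring
    rw [add_assoc (∑ i, (μ i : ℂ) ^ 2), h1, ← Finset.sum_add_distrib, ← Finset.sum_add_distrib]
    exact Finset.sum_congr rfl fun i _ => by ring
  · intro p hp
    have h1 := U.X_mul_wtTrace_e_mul p.1 p.2 (U.e p.2 p.1 * Q)
    have h2 : U.e p.2 p.1 * Q * U.e p.1 p.2 = U.e p.2 p.1 * (U.e p.1 p.2 * Q) := by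
      rw [mul_assoc, (hQ _ _ ((mem_blockPairs P).1 hp).2).eq]
    rw [h2, hcomm] at h1
    linear_combination -h1
  · have := congrArg U.wtTrace (casimir_mul_eq hW hQW hv hvW)
    rw [map_smul, smul_eq_C_mul] at this
    rw [← this, casimir_eq, add_mul, Finset.sum_mul, Finset.sum_mul, map_add, map_sum, map_sum,
      laplacian]
    congr 1
    · refine Finset.sum_congr rfl fun i _ => ?_
      rw [mul_assoc, wtTrace_e_diag_mul, wtTrace_e_diag_mul]
    · refine Finset.sum_congr rfl fun p _ => ?_
      rw [add_mul, map_add, mul_assoc, mul_assoc, hcomm]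
      ring
  · have := congrArg U.wtTrace (pairSum_mul_eq hW hQW hv hvW)
    rw [map_smul, smul_eq_C_mul] at this
    rw [← this, pairSum, Finset.sum_mul, map_sum]
    refine Finset.sum_congr rfl fun p _ => ?_
    rw [add_mul, map_add, wtTrace_e_diag_mul, wtTrace_e_diag_mul]

/-! ### Dominance of highest weights -/

variable (U) in
/-- The contravariant Hermitian form. -/
def form (u w : V) : ℂ :=
  ∑ c, (U.normSq c : ℂ) * (starRingEnd ℂ (U.basis.repr u c) * U.basis.repr w c)

lemma form_e_left (i l : Fin N) (u w : V) : U.form (U.e i l u) w = U.form u (U.e l i w) := by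
  simp only [form, U.repr_apply (U.e i l) u, U.repr_apply (U.e l i) w, map_sum, map_mul,
    Finset.mul_sum, Finset.sum_mul]
  rw [Finset.sum_comm]
  refine Finset.sum_congr rfl fun c _ => Finset.sum_congr rfl fun c' _ => ?_
  linear_combination (starRingEnd ℂ (U.basis.repr u c) * U.basis.repr w c') * U.adj i l c c'

lemma form_self (u : V) :
    U.form u u = ((∑ c, U.normSq c * Complex.normSq (U.basis.repr u c) : ℝ) : ℂ) := by
  simp only [form, Complex.ofReal_sum, Complex.ofReal_mul, Complex.normSq_eq_conj_mul_self]

lemma form_self_nonneg (u : V) : 0 ≤ (U.form u u).re := by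
  rw [form_self, Complex.ofReal_re]
  exact Finset.sum_nonneg fun c _ => mul_nonneg (U.normSq_pos c).le (Complex.normSq_nonneg _)

lemma eq_zero_of_form_self {u : V} (h : U.form u u = 0) : u = 0 := by
  rw [form_self, Complex.ofReal_eq_zero, Finset.sum_eq_zero_iff_of_nonneg fun c _ =>
    mul_nonneg (U.normSq_pos c).le (Complex.normSq_nonneg _)] at h
  refine U.basis.ext_elem fun c => ?_
  have := (mul_eq_zero.1 (h c (Finset.mem_univ c))).resolve_left (U.normSq_pos c).ne'
  simpa using this

lemma IsHighest.dominant (hv : U.IsHighest P μ v) {p : Fin N × Fin N} (hp : p ∈ blockPairs P) :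
    μ p.2 ≤ μ p.1 := by
  have h1 := form_e_left (U := U) p.2 p.1 v (U.e p.2 p.1 v)
  rw [hv.e_e_apply hp] at h1
  have h2 : U.form v (((μ p.1 : ℂ) - μ p.2) • v) = ((μ p.1 : ℂ) - μ p.2) * U.form v v := by
    simp only [form, map_smul, Finsupp.smul_apply, smul_eq_mul, Finset.mul_sum]
    exact Finset.sum_congr rfl fun c _ => by ring
  have h3 := form_self_nonneg (U := U) (U.e p.2 p.1 v)
  have h4 := form_self_nonneg (U := U) v
  have h5 : (U.form v v).re ≠ 0 := by
    intro h
    refine hv.1 (eq_zero_of_form_self (U := U) ?_)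
    rw [form_self] at h ⊢
    rw [Complex.ofReal_re] at h
    rw [h, Complex.ofReal_zero]
  rw [h1, h2, ← Int.cast_sub, ← Complex.ofReal_intCast, Complex.re_ofReal_mul] at h3
  have h6 := nonneg_of_mul_nonneg_left h3 (lt_of_le_of_ne h4 h5.symm)
  exact sub_nonneg.1 (by exact_mod_cast h6)

/-! ### The multiplicity of a highest weight in an irreducible summand -/

lemma repr_proj_ne_zero {c : ι} (h : U.basis.repr (Q (U.basis c)) c ≠ 0) : Q (U.basis c) ≠ 0 := by
  intro h0
  simp [h0] at h

lemma sub_wtInt_mem_rootCone (hW : U.Irreducible P W) (hQW : ∀ x, Q x ∈ W)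
    (hQ : ∀ i l, P i l → Commute Q (U.e i l)) (hv : U.IsHighest P μ v) (hvW : v ∈ W) {c : ι}
    (h : U.basis.repr (Q (U.basis c)) c ≠ 0) : μ - U.wtInt c ∈ rootCone P :=
  hW.sub_mem_rootCone hv hvW (hQW _) (HasWeight.of_commute hQ (U.hasWeight_basis c))
    (repr_proj_ne_zero h)

lemma eq_of_coeff_ne_zero (hW : U.Irreducible P W) (hQW : ∀ x, Q x ∈ W)
    (hQ : ∀ i l, P i l → Commute Q (U.e i l)) (hv : U.IsHighest P μ v) (hvW : v ∈ W)
    {lam : Fin N → ℤ} (hlam : ∀ p ∈ blockPairs P, lam p.2 ≤ lam p.1) {d : Fin N →₀ ℕ}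
    (hd : ∀ i, (d i : ℤ) = lam i + blockRank P i)
    (h : (blockVandermonde P ℂ * U.wtTrace Q).coeff d ≠ 0) : lam = μ := by
  classical
  have hnorm := sum_sq_eq_of_coeff_ne_zero
    (laplacian_blockVandermonde_mul_wtTrace hW hQW hQ hv hvW) h
  have hnorm' : ∑ i, (d i : ℤ) ^ 2 = ∑ i, (μ i + blockRank P i) ^ 2 := by exact_mod_cast hnorm
  rw [coeff_blockVandermonde_mul_wtTrace hd] at h
  obtain ⟨S, hS, hS0⟩ := Finset.exists_ne_zero_of_sum_ne_zero h
  obtain ⟨c, hc, hc0⟩ := Finset.exists_ne_zero_of_sum_ne_zero (right_ne_zero_of_mul hS0)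
  have hcone : μ - lam ∈ rootCone P := by
    have h1 := add_mem (sub_wtInt_mem_rootCone hW hQW hQ hv hvW hc0)
      (rootSum_mem_rootCone (Finset.mem_powerset.1 hS))
    rw [(Finset.mem_filter.1 hc).2] at h1
    convert h1 using 1
    abel
  have hpos : ∀ p ∈ blockPairs P,
      lam p.2 + μ p.2 + 2 * blockRank P p.2 < lam p.1 + μ p.1 + 2 * blockRank P p.1 := by
    intro p hp
    have h1 := hlam p hp
    have h2 := hv.dominant hp
    obtain ⟨h3, h4⟩ := (mem_blockPairs P).1 hp
    have := blockRank_lt P h3 h4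
    omega
  rcases eq_zero_or_pos_of_mem_rootCone
    (x := fun i => lam i + μ i + 2 * blockRank P i) hpos hcone with h0 | h0
  · exact (sub_eq_zero.1 h0).symm
  · exfalso
    have : ∑ i, (lam i + μ i + 2 * blockRank P i) * (μ - lam) i =
        ∑ i, (μ i + blockRank P i) ^ 2 - ∑ i, (d i : ℤ) ^ 2 := by
      rw [← Finset.sum_sub_distrib]
      refine Finset.sum_congr rfl fun i _ => ?_
      rw [hd, Pi.sub_apply]
      ring
    rw [this, hnorm', sub_self] at h0
    exact h0.false

lemma coeff_eq_one (hW : U.Irreducible P W) (hQW : ∀ x, Q x ∈ W) (hQid : ∀ x ∈ W, Q x = x)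
    (hQ : ∀ i l, P i l → Commute Q (U.e i l)) (hv : U.IsHighest P μ v) (hvW : v ∈ W)
    {d : Fin N →₀ ℕ} (hd : ∀ i, (d i : ℤ) = μ i + blockRank P i) :
    (blockVandermonde P ℂ * U.wtTrace Q).coeff d = 1 := by
  classical
  rw [coeff_blockVandermonde_mul_wtTrace hd, Finset.sum_eq_single ∅]
  · have h1 : ∀ c, U.wtInt c = μ → ∃ a : ℂ, Q (U.basis c) = a • v := by
      intro c hc
      have := hW.mem_span_of_hasWeight hv hvW (hQW (U.basis c))
        (hc ▸ HasWeight.of_commute hQ (U.hasWeight_basis c))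
      obtain ⟨a, ha⟩ := Submodule.mem_span_singleton.1 this
      exact ⟨a, ha.symm⟩
    choose! f hf using h1
    have h2 : ∑ c with U.wtInt c = μ, U.basis.repr v c * f c = 1 := by
      refine smul_left_injective ℂ hv.1 ?_
      simp only [one_smul, Finset.sum_smul]
      conv_rhs => rw [← hQid v hvW, ← U.basis.sum_repr v, map_sum]
      rw [Finset.sum_filter]
      refine Finset.sum_congr rfl fun c _ => ?_
      split_ifs with hc
      · rw [map_smul, hf c hc, smul_smul]
      · have : U.basis.repr v c = 0 := by
          by_contra h
          exact hc (hv.2.2.wtInt_eq h)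
        rw [this, zero_smul, map_zero]
    simp only [Finset.card_empty, pow_zero, one_mul, rootSum, Finset.sum_empty, add_zero]
    rw [← h2]
    refine Finset.sum_congr rfl fun c hc => ?_
    rw [hf c (Finset.mem_filter.1 hc).2, map_smul, Finsupp.smul_apply, smul_eq_mul, mul_comm]
  · intro S hS hne
    rw [Finset.sum_eq_zero, mul_zero]
    intro c hc
    by_contra h
    have h1 := height_nonneg (sub_wtInt_mem_rootCone hW hQW hQ hv hvW h)
    have h2 := rootSum_ne_zero (Finset.mem_powerset.1 hS) (Finset.nonempty_iff_ne_empty.2 hne)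
    rw [(Finset.mem_filter.1 hc).2, sub_add_cancel_left] at h1
    have h3 := height_add (rootSum S) (-rootSum S)
    have h4 : height (0 : Fin N → ℤ) = 0 := by simp [height]
    rw [add_neg_cancel, h4] at h3
    omega
  · intro h
    exact absurd (Finset.empty_mem_powerset _) h

lemma exists_isHighest (hW0 : W ≠ ⊥) (hQW : ∀ x, Q x ∈ W) (hQid : ∀ x ∈ W, Q x = x)
    (hQ : ∀ i l, P i l → Commute Q (U.e i l)) : ∃ v ∈ W, ∃ μ, U.IsHighest P μ v := by
  classical
  have hex : (Finset.univ.filter fun c => Q (U.basis c) ≠ 0).Nonempty := by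
    by_contra h
    rw [Finset.not_nonempty_iff_eq_empty, Finset.filter_eq_empty_iff] at h
    have hQ0 : Q = 0 := U.basis.ext fun c => by simpa using h (Finset.mem_univ c)
    refine hW0 ((Submodule.eq_bot_iff W).2 fun x hx => ?_)
    rw [← hQid x hx, hQ0, LinearMap.zero_apply]
  obtain ⟨c, hc, hmax⟩ := Finset.exists_max_image _ (fun c => height (U.wtInt c)) hex
  refine ⟨Q (U.basis c), hQW _, U.wtInt c, (Finset.mem_filter.1 hc).2, fun i l hil hP => ?_,
    HasWeight.of_commute hQ (U.hasWeight_basis c)⟩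
  have := LinearMap.congr_fun (hQ i l hP).eq (U.basis c)
  simp only [Module.End.mul_apply] at this
  rw [← this, ← U.basis.sum_repr (U.e i l (U.basis c)), map_sum]
  refine Finset.sum_eq_zero fun c' _ => ?_
  rw [map_smul]
  by_cases h : U.basis.repr (U.e i l (U.basis c)) c' = 0
  · rw [h, zero_smul]
  · have h1 := wtInt_eq_of_repr_e_ne_zero h
    have h2 : Q (U.basis c') = 0 := by
      by_contra h2
      have h3 := hmax c' (by simpa using h2)
      have h4 := height_rootVec_pos ((mem_blockPairs P).2 (⟨hil, hP⟩ : (i, l).1 < (i, l).2 ∧ _))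
      simp only [h1, height_add] at h3
      omega
    rw [h2, smul_zero]

open scoped Classical in
lemma coeff_eq_ite (hW : U.Irreducible P W) (hQW : ∀ x, Q x ∈ W) (hQid : ∀ x ∈ W, Q x = x)
    (hQ : ∀ i l, P i l → Commute Q (U.e i l)) {lam : Fin N → ℤ}
    (hlam : ∀ p ∈ blockPairs P, lam p.2 ≤ lam p.1) {d : Fin N →₀ ℕ}
    (hd : ∀ i, (d i : ℤ) = lam i + blockRank P i) :
    (blockVandermonde P ℂ * U.wtTrace Q).coeff d =
      if ∃ v ∈ W, U.IsHighest P lam v then 1 else 0 := by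
  split_ifs with h
  · obtain ⟨v, hvW, hv⟩ := h
    exact coeff_eq_one hW hQW hQid hQ hv hvW hd
  · obtain ⟨v, hvW, μ, hv⟩ := exists_isHighest hW.2.1 hQW hQid hQ
    by_contra h0
    obtain rfl := eq_of_coeff_ne_zero hW hQW hQ hv hvW hlam hd h0
    exact h ⟨v, hvW, hv⟩

end Projection

/-! ### Decompositions into irreducible summands -/

lemma exists_projections {m : ℕ} {W : Fin m → Submodule ℂ V} (hinv : ∀ a, U.Invariant P (W a))
    (hW : DirectSum.IsInternal W) :
    ∃ Q : Fin m → Module.End ℂ V, (∀ a x, Q a x ∈ W a) ∧ (∀ a, ∀ x ∈ W a, Q a x = x) ∧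
      (∀ a i l, P i l → Commute (Q a) (U.e i l)) ∧ ∑ a, Q a = 1 := by
  classical
  let E := LinearEquiv.ofBijective (DirectSum.coeLinearMap W) hW
  let Q : Fin m → Module.End ℂ V := fun a =>
    (W a).subtype ∘ₗ DirectSum.component ℂ (Fin m) (fun b => W b) a ∘ₗ E.symm.toLinearMap
  have hE : ∀ a (x : W a), E.symm x = DirectSum.lof ℂ (Fin m) (fun b => W b) a x := by
    intro a x
    rw [LinearEquiv.symm_apply_eq]
    exact (DirectSum.coeLinearMap_lof W a x).symm
  have hQ : ∀ a b, ∀ x ∈ W b, Q a x = if a = b then x else 0 := by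
    intro a b x hx
    have h1 := hE b ⟨x, hx⟩
    simp only at h1
    simp only [Q, LinearMap.comp_apply, LinearEquiv.coe_coe, h1, Submodule.subtype_apply]
    split_ifs with h
    · subst h
      rw [DirectSum.component.lof_self]
    · rw [DirectSum.component.of, dif_neg (fun h' => h h'.symm)]
      rfl
  have htop : ∀ T T' : Module.End ℂ V, (∀ b, ∀ x ∈ W b, T x = T' x) → T = T' := by
    intro T T' h
    have : (⊤ : Submodule ℂ V) ≤ LinearMap.eqLocus T T' := by
      rw [← hW.submodule_iSup_eq_top]
      exact iSup_le fun b x hx => h b x hx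
    exact LinearMap.ext fun x => this Submodule.mem_top
  refine ⟨Q, fun a x => Subtype.property _, fun a x hx => by rw [hQ a a x hx, if_pos rfl],
    fun a i l hil => htop _ _ fun b x hx => ?_, htop _ _ fun b x hx => ?_⟩
  · simp only [Module.End.mul_apply]
    rw [hQ a b x hx, hQ a b _ (hinv b i l hil x hx)]
    split_ifs <;> simp
  · simp only [LinearMap.sum_apply, Module.End.one_apply]
    rw [Finset.sum_congr rfl fun a _ => hQ a b x hx]
    simp

open scoped Classical in
/-- The number of irreducible summands with a given highest weight is the alternating sum of the
weight multiplicities. -/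
lemma card_isHighest {m : ℕ} {W : Fin m → Submodule ℂ V} (hirr : ∀ a, U.Irreducible P (W a))
    (hW : DirectSum.IsInternal W) {lam : Fin N → ℤ}
    (hlam : ∀ p ∈ blockPairs P, lam p.2 ≤ lam p.1) (hpos : ∀ i, 0 ≤ lam i) :
    (Nat.card {a // ∃ v ∈ W a, U.IsHighest P lam v} : ℤ) =
      ∑ S ∈ (blockPairs P).powerset, (-1 : ℤ) ^ S.card *
        ((Finset.univ.filter fun c => U.wtInt c = lam + rootSum S).card : ℤ) := by
  obtain ⟨Q, hQW, hQid, hQ, hsum⟩ := exists_projections (fun a => (hirr a).1) hW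
  let d : Fin N →₀ ℕ := Finsupp.equivFunOnFinite.symm fun i => (lam i).toNat + blockRank P i
  have hd : ∀ i, (d i : ℤ) = lam i + blockRank P i := by
    intro i
    simp [d, Int.toNat_of_nonneg (hpos i)]
  have h1 : (blockVandermonde P ℂ * U.wtTrace 1).coeff d =
      ∑ a, if ∃ v ∈ W a, U.IsHighest P lam v then 1 else 0 := by
    rw [← hsum, map_sum, Finset.mul_sum, coeff_sum]
    exact Finset.sum_congr rfl fun a _ => coeff_eq_ite (hirr a) (hQW a) (hQid a) (hQ a) hlam hd
  rw [coeff_blockVandermonde_mul_wtTrace hd] at h1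
  simp only [Module.End.one_apply, Module.Basis.repr_self, Finsupp.single_eq_same,
    Finset.sum_const, nsmul_eq_mul, mul_one, Finset.sum_boole] at h1
  rw [Nat.card_eq_fintype_card, Fintype.card_subtype]
  exact_mod_cast h1.symm

end UnitaryGlModule

end

end PartialTwist

namespace PartialTwist

noncomputable section

variable {N : ℕ} {P : Setoid (Fin N)}

namespace UnitaryGlModule

variable {ι V : Type*} [Fintype ι] [AddCommGroup V] [Module ℂ V] {U : UnitaryGlModule N ι V}

variable (U) in
/-- The contravariant form as an inner product. -/
abbrev core : InnerProductSpace.Core ℂ V where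
  inner := U.form
  conj_inner_symm x y := by
    simp only [form, map_sum, map_mul, Complex.conj_ofReal, Complex.conj_conj]
    exact Finset.sum_congr rfl fun c _ => by ring
  re_inner_nonneg := form_self_nonneg
  add_left x y z := by
    simp only [form, map_add, Finsupp.add_apply, ← Finset.sum_add_distrib]
    exact Finset.sum_congr rfl fun c _ => by ring
  smul_left x y a := by
    simp only [form, map_smul, Finsupp.smul_apply, smul_eq_mul, map_mul, Finset.mul_sum]
    exact Finset.sum_congr rfl fun c _ => by ring
  definite _ := eq_zero_of_form_self

lemma exists_irreducible_le [FiniteDimensional ℂ V] {X : Submodule ℂ V} (hX : U.Invariant P X)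
    (hX0 : X ≠ ⊥) : ∃ Y ≤ X, U.Irreducible P Y := by
  obtain ⟨Y, ⟨hY, hY0, hYX⟩, hmin⟩ := (wellFounded_lt (α := Submodule ℂ V)).has_min
    {Y | U.Invariant P Y ∧ Y ≠ ⊥ ∧ Y ≤ X} ⟨X, hX, hX0, le_rfl⟩
  refine ⟨Y, hYX, hY, hY0, fun Z hZ hZY => ?_⟩
  by_contra! h
  exact hmin Z ⟨hZ, h.1, hZY.trans hYX⟩ (lt_of_le_of_ne hZY h.2)

variable (P U) in
lemma exists_isInternal : ∃ (m : ℕ) (W : Fin m → Submodule ℂ V),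
    (∀ a, U.Irreducible P (W a)) ∧ DirectSum.IsInternal W := by
  classical
  let := U.core
  let : NormedAddCommGroup V := InnerProductSpace.Core.toNormedAddCommGroup (𝕜 := ℂ)
  let : InnerProductSpace ℂ V := InnerProductSpace.ofCore U.core.toCore
  have : FiniteDimensional ℂ V := U.basis.finiteDimensional_of_finite
  have hadj : ∀ i l (u w : V), inner ℂ (U.e i l u) w = inner ℂ u (U.e l i w) := form_e_left
  have key : ∀ X : Submodule ℂ V, U.Invariant P X → ∃ s : Finset (Submodule ℂ V),
      (∀ Y ∈ s, U.Irreducible P Y) ∧ (∀ Y ∈ s, ∀ Z ∈ s, Y ≠ Z → Y ⟂ Z) ∧ s.sup id = X := by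
    intro X
    induction X using WellFoundedLT.induction with
    | ind X ih =>
      intro hX
      by_cases hX0 : X = ⊥
      · exact ⟨∅, by simp, by simp, by simp [hX0]⟩
      obtain ⟨Y, hYX, hY⟩ := exists_irreducible_le hX hX0
      have hsup := Submodule.sup_orthogonal_inf_of_hasOrthogonalProjection hYX
      have hinv : U.Invariant P (Yᗮ ⊓ X) := by
        intro i l hil x hx
        refine ⟨(Submodule.mem_orthogonal _ _).2 fun y hy => ?_, hX i l hil x hx.2⟩
        rw [← hadj]
        exact (Submodule.mem_orthogonal _ _).1 hx.1 _ (hY.1 l i (P.symm' hil) y hy)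
      have hlt : Yᗮ ⊓ X < X := by
        refine lt_of_le_of_ne inf_le_right fun h => hY.2.1 ?_
        have h1 : Y ≤ Yᗮ := hYX.trans (inf_eq_right.1 h)
        have h2 := Submodule.inf_orthogonal_eq_bot Y
        rwa [inf_eq_left.2 h1] at h2
      obtain ⟨s, hs, hso, hsX⟩ := ih _ hlt hinv
      have hYs : ∀ Z ∈ s, Y ⟂ Z := fun Z hZ =>
        (Submodule.isOrtho_comm).1 (((Finset.le_sup (f := id) hZ).trans hsX.le).trans inf_le_left)
      refine ⟨insert Y s, ?_, ?_, ?_⟩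
      · intro Z hZ
        rcases Finset.mem_insert.1 hZ with rfl | hZ
        · exact hY
        · exact hs Z hZ
      · intro Z hZ Z' hZ' hne
        rcases Finset.mem_insert.1 hZ with h1 | h1 <;> rcases Finset.mem_insert.1 hZ' with h2 | h2
        · exact absurd (h1.trans h2.symm) hne
        · exact h1 ▸ hYs _ h2
        · exact h2 ▸ (hYs _ h1).symm
        · exact hso _ h1 _ h2 hne
      · rw [Finset.sup_insert, hsX, id]
        exact hsup
  obtain ⟨s, hs, hso, hsX⟩ := key ⊤ fun _ _ _ _ _ => Submodule.mem_top
  let W : Fin s.card → Submodule ℂ V := fun a => (s.equivFin.symm a).1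
  refine ⟨s.card, W, fun a => hs _ (s.equivFin.symm a).2, ?_⟩
  have hfam : OrthogonalFamily ℂ (fun a => W a) fun a => (W a).subtypeₗᵢ := by
    refine OrthogonalFamily.of_pairwise fun a b hab => ?_
    exact hso _ (s.equivFin.symm a).2 _ (s.equivFin.symm b).2 fun h =>
      hab (s.equivFin.symm.injective (Subtype.ext h))
  rw [hfam.isInternal_iff]
  have : iSup W = ⊤ := by
    rw [← hsX, Finset.sup_eq_iSup, eq_comm]
    refine le_antisymm (iSup₂_le fun Y hY => ?_) (iSup_le fun a => ?_)
    · have : W (s.equivFin ⟨Y, hY⟩) = Y := by simp [W]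
      rw [id, ← this]
      exact le_iSup W _
    · exact le_iSup₂ (f := fun (Y : Submodule ℂ V) (_ : Y ∈ s) => id Y) _ (s.equivFin.symm a).2
  rw [this, Submodule.top_orthogonal_eq_bot]

end UnitaryGlModule

end

end PartialTwist

namespace PartialTwist

noncomputable section

open MvPolynomial

/-- The exponents of the monomials of degree `k`. -/
abbrev SiteIndex (r k : ℕ) : Type :=
  {d : Fin (r + 1) →₀ ℕ // d ∈ Finset.finsuppAntidiag Finset.univ k}

lemma SiteIndex.sum_eq {r k : ℕ} (d : SiteIndex r k) : ∑ i, d.1 i = k :=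
  (Finset.mem_finsuppAntidiag.1 d.2).1

lemma SiteIndex.degree_eq {r k : ℕ} (d : SiteIndex r k) : d.1.degree = k := by
  rw [Finsupp.degree_eq_sum]
  exact d.sum_eq

lemma mem_finsuppAntidiag_univ {r k : ℕ} {d : Fin (r + 1) →₀ ℕ} (h : d.degree = k) :
    d ∈ Finset.finsuppAntidiag Finset.univ k := by
  rw [Finset.mem_finsuppAntidiag, ← h, Finsupp.degree_eq_sum]
  exact ⟨rfl, Finset.subset_univ _⟩

/-- The basis of monomials of `Sym^k`. -/
def siteBasis (r k : ℕ) : Module.Basis (SiteIndex r k) ℂ (Site r k) :=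
  Module.Basis.ofEquivFun
    { toFun := fun f d => coeff d.1 f.1
      map_add' := fun f g => by ext; simp
      map_smul' := fun a f => by ext; simp
      invFun := fun g => ∑ d, ⟨monomial d.1 (g d), by
        rw [mem_homogeneousSubmodule]
        exact isHomogeneous_monomial _ d.degree_eq⟩
      left_inv := fun f => by
        apply Subtype.ext
        ext d
        simp only [AddSubmonoidClass.coe_finsetSum, coeff_sum, coeff_monomial]
        by_cases hd : d.degree = k
        · rw [Finset.sum_eq_single ⟨d, mem_finsuppAntidiag_univ hd⟩]
          · simp
          · intro e _ hne
            rw [if_neg fun h => hne (Subtype.ext h)]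
          · simp
        · rw [Finset.sum_eq_zero]
          · refine (((mem_homogeneousSubmodule _ _).1 f.2).coeff_eq_zero ?_).symm
            simpa using hd
          · intro e _
            rw [if_neg]
            rintro rfl
            exact hd e.degree_eq
      right_inv := fun g => by
        ext d
        simp only [AddSubmonoidClass.coe_finsetSum, coeff_sum, coeff_monomial]
        rw [Finset.sum_eq_single d]
        · simp
        · intro e _ hne
          rw [if_neg fun h => hne (Subtype.ext h)]
        · simp }

lemma siteBasis_repr {r k : ℕ} (f : Site r k) (d : SiteIndex r k) :
    (siteBasis r k).repr f d = coeff d.1 f.1 := rfl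

lemma siteBasis_apply {r k : ℕ} (d : SiteIndex r k) :
    ((siteBasis r k d : Site r k) : MvPolynomial (Fin (r + 1)) ℂ) = monomial d.1 1 := by
  have : siteBasis r k d = ⟨monomial d.1 1, by
      rw [mem_homogeneousSubmodule]
      exact isHomogeneous_monomial _ d.degree_eq⟩ := by
    refine (siteBasis r k).ext_elem fun e => ?_
    rw [Module.Basis.repr_self, siteBasis_repr, coeff_monomial, Finsupp.single_apply]
    simp only [Subtype.ext_iff]
  rw [this]

lemma polyAct_single {r : ℕ} (i l : Fin (r + 1)) (f : MvPolynomial (Fin (r + 1)) ℂ) :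
    polyAct (Matrix.single i l 1) f = X i * pderiv l f := by
  rw [polyAct, LinearMap.sum_apply, Finset.sum_eq_single i, LinearMap.sum_apply,
    Finset.sum_eq_single l]
  · simp
  · intro m _ hm
    simp [hm.symm]
  · simp
  · intro m _ hm
    simp [hm.symm]
  · simp

lemma polyAct_add {r : ℕ} (A B : Matrix (Fin (r + 1)) (Fin (r + 1)) ℂ) :
    polyAct (A + B) = polyAct A + polyAct B := by
  simp only [polyAct, Matrix.add_apply, add_smul, Finset.sum_add_distrib]

lemma polyAct_smul {r : ℕ} (a : ℂ) (A : Matrix (Fin (r + 1)) (Fin (r + 1)) ℂ) :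
    polyAct (a • A) = a • polyAct A := by
  simp only [polyAct, Matrix.smul_apply, Finset.smul_sum, smul_smul, smul_eq_mul]

lemma pderiv_comm {σ R : Type*} [CommRing R] (i j : σ) (f : MvPolynomial σ R) :
    pderiv i (pderiv j f) = pderiv j (pderiv i f) := by
  classical
  have h : ⁅(pderiv i : Derivation R (MvPolynomial σ R) (MvPolynomial σ R)), (pderiv j :
      Derivation R (MvPolynomial σ R) (MvPolynomial σ R))⁆ = 0 := by
    refine derivation_ext fun m => ?_
    rw [Derivation.commutator_apply, pderiv_X, pderiv_X, Pi.single_apply, Pi.single_apply]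
    split_ifs <;> simp
  have := Derivation.congr_fun h f
  rwa [Derivation.commutator_apply, Derivation.zero_apply, sub_eq_zero] at this

lemma polyAct_comm {r : ℕ} (i j k l : Fin (r + 1)) (f : MvPolynomial (Fin (r + 1)) ℂ) :
    polyAct (Matrix.single i j 1) (polyAct (Matrix.single k l 1) f) =
      polyAct (Matrix.single k l 1) (polyAct (Matrix.single i j 1) f) +
      ((if j = k then polyAct (Matrix.single i l 1) f else 0) -
        if l = i then polyAct (Matrix.single k j 1) f else 0) := by
  simp only [polyAct_single, pderiv_mul, pderiv_X, Pi.single_apply, eq_comm (a := k),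
    eq_comm (a := i)]
  rw [pderiv_comm j l f]
  split_ifs <;> ring

variable {r : ℕ} (k L : ℕ)

instance instAddCommGroupChain (r k L : ℕ) : AddCommGroup (Chain r k L) :=
  Module.addCommMonoidToAddCommGroup ℂ

lemma coe_siteAct (A : Matrix (Fin (r + 1)) (Fin (r + 1)) ℂ) (f : Site r k) :
    (siteAct k A f : MvPolynomial (Fin (r + 1)) ℂ) = polyAct A f := rfl

/-- `siteAct` as a linear map. -/
def siteActLin : Matrix (Fin (r + 1)) (Fin (r + 1)) ℂ →ₗ[ℂ] Module.End ℂ (Site r k) where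
  toFun := siteAct k
  map_add' A B := by
    ext f : 2
    simp [siteAct, polyAct_add]
  map_smul' a A := by
    ext f : 2
    simp [siteAct, polyAct_smul]

/-- An operator on the `n`-th site. -/
def siteOp (n : Fin L) : Module.End ℂ (Site r k) →ₗ[ℂ] Module.End ℂ (Chain r k L) :=
  (PiTensorProduct.mapMultilinear ℂ (fun _ : Fin L => Site r k) fun _ => Site r k).toLinearMap
    (fun _ => LinearMap.id) n

lemma siteOp_apply (n : Fin L) (T : Module.End ℂ (Site r k)) :
    siteOp k L n T = PiTensorProduct.map
      (Function.update (fun _ : Fin L => (LinearMap.id : Site r k →ₗ[ℂ] Site r k)) n T) := rfl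

/-- `chainAct` as a linear map. -/
def chainActLin : Matrix (Fin (r + 1)) (Fin (r + 1)) ℂ →ₗ[ℂ] Module.End ℂ (Chain r k L) :=
  ∑ n, siteOp k L n ∘ₗ siteActLin k

lemma chainActLin_apply (A : Matrix (Fin (r + 1)) (Fin (r + 1)) ℂ) :
    chainActLin k L A = chainAct k L A := by
  simp only [chainActLin, LinearMap.sum_apply, LinearMap.comp_apply]
  rfl

lemma chainAct_eq_sum_siteOp (A : Matrix (Fin (r + 1)) (Fin (r + 1)) ℂ) :
    chainAct k L A = ∑ n, siteOp k L n (siteAct k A) := rfl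

lemma chainAct_eq_sum (A : Matrix (Fin (r + 1)) (Fin (r + 1)) ℂ) :
    chainAct k L A = ∑ i, ∑ l, A i l • chainAct k L (Matrix.single i l 1) := by
  simp only [← chainActLin_apply, ← map_smul, ← map_sum]
  congr 1
  conv_lhs => rw [Matrix.matrix_eq_sum_single A]
  simp [Matrix.smul_single]

lemma siteOp_mul (n : Fin L) (S T : Module.End ℂ (Site r k)) :
    siteOp k L n (S * T) = siteOp k L n S * siteOp k L n T := by
  rw [siteOp_apply, siteOp_apply, siteOp_apply, ← PiTensorProduct.map_mul]
  congr 1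
  funext m
  rcases eq_or_ne m n with rfl | h
  · simp
  · simp only [Function.update_of_ne h]
    rfl

lemma siteOp_commute {n m : Fin L} (h : n ≠ m) (S T : Module.End ℂ (Site r k)) :
    siteOp k L n S * siteOp k L m T = siteOp k L m T * siteOp k L n S := by
  rw [siteOp_apply, siteOp_apply, ← PiTensorProduct.map_mul, ← PiTensorProduct.map_mul]
  congr 1
  funext p
  rcases eq_or_ne p n with rfl | h1
  · simp only [Function.update_self, Function.update_of_ne h]
    rfl
  · simp only [Function.update_of_ne h1]
    rfl

lemma chainAct_mul_add {A B : Matrix (Fin (r + 1)) (Fin (r + 1)) ℂ}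
    {S T : Module.End ℂ (Site r k)}
    (h : siteAct k A * siteAct k B + S = siteAct k B * siteAct k A + T) :
    chainAct k L A * chainAct k L B + ∑ n, siteOp k L n S =
      chainAct k L B * chainAct k L A + ∑ n, siteOp k L n T := by
  have key : ∀ n m, siteOp k L n (siteAct k A) * siteOp k L m (siteAct k B) +
      (if n = m then siteOp k L n S else 0) =
      siteOp k L m (siteAct k B) * siteOp k L n (siteAct k A) +
      if n = m then siteOp k L n T else 0 := by
    intro n m
    by_cases hnm : n = m
    · subst hnm
      simp only [if_true]
      rw [← siteOp_mul, ← siteOp_mul, ← map_add, ← map_add, h]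
    · rw [if_neg hnm, if_neg hnm, siteOp_commute k L hnm]
  have hsum := Finset.sum_congr (rfl : (Finset.univ : Finset (Fin L)) = Finset.univ)
    fun n _ => Finset.sum_congr (rfl : (Finset.univ : Finset (Fin L)) = Finset.univ)
      fun m _ => key n m
  simp only [Finset.sum_add_distrib, Finset.sum_ite_eq, Finset.mem_univ, if_true] at hsum
  rw [Finset.sum_comm (f := fun n m => siteOp k L m (siteAct k B) * siteOp k L n (siteAct k A))]
    at hsum
  simp only [chainAct_eq_sum_siteOp, Finset.sum_mul_sum]
  exact hsum

lemma siteAct_comm (i j p q : Fin (r + 1)) :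
    siteAct k (Matrix.single i j 1) * siteAct k (Matrix.single p q 1) +
      (if q = i then siteAct k (Matrix.single p j 1) else 0) =
    siteAct k (Matrix.single p q 1) * siteAct k (Matrix.single i j 1) +
      if j = p then siteAct k (Matrix.single i q 1) else 0 := by
  refine LinearMap.ext fun f => Subtype.ext ?_
  have := polyAct_comm i j p q f.1
  rw [← add_sub_assoc, eq_sub_iff_add_eq] at this
  split_ifs at this ⊢ <;> exact this

lemma chainAct_comm (i j p q : Fin (r + 1)) :
    chainAct k L (Matrix.single i j 1) * chainAct k L (Matrix.single p q 1) =
      chainAct k L (Matrix.single p q 1) * chainAct k L (Matrix.single i j 1) +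
      ((if j = p then chainAct k L (Matrix.single i q 1) else 0) -
        if q = i then chainAct k L (Matrix.single p j 1) else 0) := by
  have h := chainAct_mul_add k L (siteAct_comm k i j p q)
  have h1 : ∀ (c : Prop) [Decidable c] (A : Matrix (Fin (r + 1)) (Fin (r + 1)) ℂ),
      ∑ n, siteOp k L n (if c then siteAct k A else 0) = if c then chainAct k L A else 0 := by
    intro c _ A
    split_ifs
    · rfl
    · simp
  rw [h1, h1] at h
  rw [← add_sub_assoc]
  exact eq_sub_of_add_eq h

/-- The basis of tensor products of monomials. -/
def chainBasis (r k L : ℕ) : Module.Basis (Fin L → SiteIndex r k) ℂ (Chain r k L) :=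
  Basis.piTensorProduct fun _ : Fin L => siteBasis r k

lemma siteAct_diag (i : Fin (r + 1)) (d : SiteIndex r k) :
    siteAct k (Matrix.single i i 1) (siteBasis r k d) = (d.1 i : ℂ) • siteBasis r k d := by
  apply Subtype.ext
  rw [coe_siteAct, Submodule.coe_smul, siteBasis_apply, polyAct_single]
  have := eulerDer_monomial i d.1 (1 : ℂ)
  rwa [eulerDer, Derivation.smul_apply, smul_eq_mul] at this

lemma siteOp_chainBasis (n : Fin L) (T : Module.End ℂ (Site r k)) (c : Fin L → SiteIndex r k) :
    siteOp k L n T (chainBasis r k L c) =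
      PiTensorProduct.tprod ℂ fun m => (Function.update
        (fun _ : Fin L => (LinearMap.id : Site r k →ₗ[ℂ] Site r k)) n T) m (siteBasis r k (c m)) := by
  rw [chainBasis, Basis.piTensorProduct_apply, siteOp_apply, PiTensorProduct.map_tprod]

lemma siteOp_diag (n : Fin L) (i : Fin (r + 1)) (c : Fin L → SiteIndex r k) :
    siteOp k L n (siteAct k (Matrix.single i i 1)) (chainBasis r k L c) =
      ((c n).1 i : ℂ) • chainBasis r k L c := by
  rw [siteOp_chainBasis, chainBasis, Basis.piTensorProduct_apply]
  have : (fun m => (Function.update (fun _ : Fin L => (LinearMap.id : Site r k →ₗ[ℂ] Site r k)) n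
      (siteAct k (Matrix.single i i 1))) m (siteBasis r k (c m))) =
      Function.update (fun m => siteBasis r k (c m)) n
        (((c n).1 i : ℂ) • siteBasis r k (c n)) := by
    funext m
    rcases eq_or_ne m n with rfl | h
    · simp [siteAct_diag]
    · simp [Function.update_of_ne h]
  rw [this, MultilinearMap.map_update_smul, Function.update_eq_self]

/-- The weight of a product of monomials. -/
def chainWeight {k L : ℕ} (c : Fin L → SiteIndex r k) : Fin (r + 1) →₀ ℕ := ∑ n, (c n).1

lemma chainAct_diag (i : Fin (r + 1)) (c : Fin L → SiteIndex r k) :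
    chainAct k L (Matrix.single i i 1) (chainBasis r k L c) =
      (chainWeight c i : ℂ) • chainBasis r k L c := by
  rw [chainAct_eq_sum_siteOp, LinearMap.sum_apply]
  simp only [siteOp_diag, ← Finset.sum_smul, chainWeight, Finsupp.finsetSum_apply, Nat.cast_sum]

/-- The square norm of a monomial. -/
def monomialNorm (d : Fin (r + 1) →₀ ℕ) : ℝ := ∏ i, ((d i).factorial : ℝ)

lemma monomialNorm_pos (d : Fin (r + 1) →₀ ℕ) : 0 < monomialNorm d :=
  Finset.prod_pos fun _ _ => by positivity

lemma monomialNorm_add_single (d : Fin (r + 1) →₀ ℕ) (i : Fin (r + 1)) :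
    monomialNorm (d + Finsupp.single i 1) = monomialNorm d * (d i + 1) := by
  simp only [monomialNorm]
  rw [← Finset.mul_prod_erase _ _ (Finset.mem_univ i),
    ← Finset.mul_prod_erase (a := i) (f := fun i => ((d i).factorial : ℝ)) _ (Finset.mem_univ i)]
  have : ∏ x ∈ Finset.univ.erase i, (((d + Finsupp.single i 1 : Fin (r + 1) →₀ ℕ) x).factorial : ℝ) =
      ∏ x ∈ Finset.univ.erase i, ((d x).factorial : ℝ) := by
    refine Finset.prod_congr rfl fun x hx => ?_
    have := (Finset.ne_of_mem_erase hx).symm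
    simp [this]
  rw [this]
  simp [Nat.factorial_succ]
  ring

lemma siteAct_repr (i l : Fin (r + 1)) (d d' : SiteIndex r k) :
    (siteBasis r k).repr (siteAct k (Matrix.single i l 1) (siteBasis r k d)) d' =
      if d'.1 + Finsupp.single l 1 = d.1 + Finsupp.single i 1 then (d.1 l : ℂ) else 0 := by
  rw [siteBasis_repr]
  rw [coe_siteAct, polyAct_single, siteBasis_apply, pderiv_monomial, one_mul, X, monomial_mul, one_mul,
    coeff_monomial]
  rcases Nat.eq_zero_or_pos (d.1 l) with h | h
  · simp [h]
  · have hle : Finsupp.single l 1 ≤ d.1 := by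
      simpa [Finsupp.single_le_iff] using Nat.succ_le_of_lt h
    have : Finsupp.single i 1 + (d.1 - Finsupp.single l 1) = d'.1 ↔
        d'.1 + Finsupp.single l 1 = d.1 + Finsupp.single i 1 := by
      constructor
      · intro h
        rw [← h, add_assoc, tsub_add_cancel_of_le hle, add_comm (Finsupp.single i 1)]
      · intro h
        refine add_right_cancel (b := Finsupp.single l 1) ?_
        rw [h, add_assoc, tsub_add_cancel_of_le hle, add_comm (Finsupp.single i 1)]
    simp only [this]

lemma siteAct_adj (i l : Fin (r + 1)) (d d' : SiteIndex r k) :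
    (monomialNorm d'.1 : ℂ) * starRingEnd ℂ
        ((siteBasis r k).repr (siteAct k (Matrix.single i l 1) (siteBasis r k d)) d') =
      monomialNorm d.1 *
        (siteBasis r k).repr (siteAct k (Matrix.single l i 1) (siteBasis r k d')) d := by
  rw [siteAct_repr, siteAct_repr]
  simp only [eq_comm (a := d.1 + Finsupp.single i 1)]
  split_ifs with h
  · rw [Complex.conj_natCast]
    rcases eq_or_ne i l with rfl | hil
    · rw [add_right_cancel h]
    · have h1 := monomialNorm_add_single d.1 i
      have h2 := monomialNorm_add_single d'.1 l
      have h3 : d'.1 i = d.1 i + 1 := by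
        simpa [Finsupp.single_apply, hil, hil.symm] using DFunLike.congr_fun h i
      have h4 : d'.1 l + 1 = d.1 l := by
        simpa [Finsupp.single_apply, hil, hil.symm] using DFunLike.congr_fun h l
      rw [h, h1] at h2
      rw [← h4, h3]
      push_cast
      exact_mod_cast h2.symm
  · simp

lemma siteOp_adj (n : Fin L) (i l : Fin (r + 1)) (c c' : Fin L → SiteIndex r k) :
    ((∏ m, monomialNorm (c' m).1 : ℝ) : ℂ) * starRingEnd ℂ ((chainBasis r k L).repr
        (siteOp k L n (siteAct k (Matrix.single i l 1)) (chainBasis r k L c)) c') =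
      ((∏ m, monomialNorm (c m).1 : ℝ) : ℂ) * (chainBasis r k L).repr
        (siteOp k L n (siteAct k (Matrix.single l i 1)) (chainBasis r k L c')) c := by
  rw [siteOp_chainBasis, siteOp_chainBasis, chainBasis, Basis.piTensorProduct_repr_tprod_apply,
    Basis.piTensorProduct_repr_tprod_apply, map_prod, Complex.ofReal_prod, Complex.ofReal_prod,
    ← Finset.prod_mul_distrib, ← Finset.prod_mul_distrib]
  refine Finset.prod_congr rfl fun m _ => ?_
  rcases eq_or_ne m n with rfl | h
  · simp only [Function.update_self]
    exact siteAct_adj k i l (c m) (c' m)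
  · simp only [Function.update_of_ne h, LinearMap.id_apply, Module.Basis.repr_self,
      Finsupp.single_apply, eq_comm (a := c' m)]
    split_ifs with h
    · simp [h]
    · simp

lemma chainAct_adj (i l : Fin (r + 1)) (c c' : Fin L → SiteIndex r k) :
    ((∏ m, monomialNorm (c' m).1 : ℝ) : ℂ) * starRingEnd ℂ ((chainBasis r k L).repr
        (chainAct k L (Matrix.single i l 1) (chainBasis r k L c)) c') =
      ((∏ m, monomialNorm (c m).1 : ℝ) : ℂ) * (chainBasis r k L).repr
        (chainAct k L (Matrix.single l i 1) (chainBasis r k L c')) c := by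
  simp only [chainAct_eq_sum_siteOp, LinearMap.sum_apply, map_sum, Finsupp.coe_finsetSum,
    Finset.sum_apply, Finset.mul_sum]
  exact Finset.sum_congr rfl fun n _ => siteOp_adj k L n i l c c'

/-- The chain as a representation of `gl_{r+1}` with an orthogonal basis of weight vectors. -/
def chainModule (r k L : ℕ) :
    UnitaryGlModule (r + 1) (Fin L → SiteIndex r k) (Chain r k L) where
  e i l := chainAct k L (Matrix.single i l 1)
  comm := chainAct_comm k L
  basis := chainBasis r k L
  wt := chainWeight
  e_diag := chainAct_diag k L
  normSq c := ∏ m, monomialNorm (c m).1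
  normSq_pos c := Finset.prod_pos fun m _ => monomialNorm_pos (c m).1
  adj := chainAct_adj k L

end

end PartialTwist

namespace PartialTwist

noncomputable section

open MvPolynomial

/-! ### The one-row Schur polynomial -/

section Schur

variable {r : ℕ}

/-- The complete homogeneous symmetric polynomial. -/
def completeHom (r k : ℕ) : MvPolynomial (Fin (r + 1)) ℤ := ∑ d : SiteIndex r k, monomial d.1 1

lemma completeHom_zero : completeHom r 0 = 1 := by
  have h : ∀ d : SiteIndex r 0, d.1 = 0 := by
    intro d
    have := d.sum_eq
    ext i
    simpa using Finset.sum_eq_zero_iff.1 this i (Finset.mem_univ i)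
  have : Unique (SiteIndex r 0) :=
    { default := ⟨0, mem_finsuppAntidiag_univ (by simp)⟩
      uniq := fun d => Subtype.ext (h d) }
  rw [completeHom, Fintype.sum_unique, h]
  rfl

lemma coeff_prod_geometric (m : ℕ) :
    PowerSeries.coeff m (∏ j : Fin (r + 1),
      PowerSeries.mk fun q => (X j : MvPolynomial (Fin (r + 1)) ℤ) ^ q) = completeHom r m := by
  rw [PowerSeries.coeff_prod, completeHom, ← Finset.sum_coe_sort]
  refine Finset.sum_congr rfl fun d _ => ?_
  simp only [PowerSeries.coeff_mk]
  rw [monomial_eq, C_1, one_mul, Finsupp.prod_fintype _ _ (by simp)]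

lemma geometric_mul (a : MvPolynomial (Fin (r + 1)) ℤ) :
    (PowerSeries.mk fun q => a ^ q) * (1 - PowerSeries.C a * PowerSeries.X) = 1 := by
  ext1 m
  cases m with
  | zero => simp
  | succ m =>
    rw [mul_sub, mul_one, map_sub, ← mul_assoc, PowerSeries.coeff_succ_mul_X, PowerSeries.coeff_mk,
      mul_comm, PowerSeries.coeff_C_mul, PowerSeries.coeff_mk, PowerSeries.coeff_one,
      if_neg (Nat.succ_ne_zero m), pow_succ', sub_self]

/-- The signed elementary symmetric polynomials in the variables other than the `j`-th, as
coefficients of `∏ (1 - x_i T)`. -/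
def elemGen (j : Fin (r + 1)) : Polynomial (MvPolynomial (Fin (r + 1)) ℤ) :=
  ∏ i ∈ Finset.univ.erase j, (1 - Polynomial.C (X i) * Polynomial.X)

lemma natDegree_elemGen_le (j : Fin (r + 1)) : (elemGen j).natDegree ≤ r := by
  refine (Polynomial.natDegree_prod_le _ _).trans ?_
  have : ∀ i ∈ Finset.univ.erase j,
      (1 - Polynomial.C (X i : MvPolynomial (Fin (r + 1)) ℤ) * Polynomial.X).natDegree ≤ 1 := by
    intro i _
    refine (Polynomial.natDegree_sub_le _ _).trans (max_le (by simp) ?_)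
    simp
  refine (Finset.sum_le_card_nsmul _ _ _ this).trans ?_
  simp

lemma pow_eq_sum_completeHom (j : Fin (r + 1)) (m : ℕ) :
    (X j : MvPolynomial (Fin (r + 1)) ℤ) ^ m = ∑ l : Fin (r + 1),
      (if (l : ℕ) ≤ m then completeHom r (m - l) else 0) * (elemGen j).coeff l := by
  have h1 : (PowerSeries.mk fun q => (X j : MvPolynomial (Fin (r + 1)) ℤ) ^ q) =
      (elemGen j : PowerSeries (MvPolynomial (Fin (r + 1)) ℤ)) * ∏ i : Fin (r + 1),
        PowerSeries.mk fun q => (X i : MvPolynomial (Fin (r + 1)) ℤ) ^ q := by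
    rw [← Finset.mul_prod_erase _ _ (Finset.mem_univ j), mul_left_comm]
    have h2 : (elemGen j : PowerSeries (MvPolynomial (Fin (r + 1)) ℤ)) =
        ∏ i ∈ Finset.univ.erase j, (1 - PowerSeries.C (X i) * PowerSeries.X) := by
      rw [elemGen, ← Polynomial.coeToPowerSeries.ringHom_apply, map_prod]
      refine Finset.prod_congr rfl fun i _ => ?_
      simp
    rw [h2, ← Finset.prod_mul_distrib, Finset.prod_eq_one, mul_one]
    intro i _
    rw [mul_comm, geometric_mul]
  have h3 := congrArg (PowerSeries.coeff m) h1
  rw [PowerSeries.coeff_mk, PowerSeries.coeff_mul,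
    Finset.Nat.sum_antidiagonal_eq_sum_range_succ_mk] at h3
  simp only [coeff_prod_geometric, Polynomial.coeff_coe] at h3
  rw [h3, Fin.sum_univ_eq_sum_range
    (fun l => (if l ≤ m then completeHom r (m - l) else 0) * (elemGen j).coeff l) (r + 1)]
  have h4 : ∀ l, r < l → (elemGen j).coeff l = 0 := fun l hl =>
    Polynomial.coeff_eq_zero_of_natDegree_lt ((natDegree_elemGen_le j).trans_lt hl)
  have h5 : ∀ l ∈ Finset.range (m + 1), (elemGen j).coeff l * completeHom r (m - l) =
      (if l ≤ m then completeHom r (m - l) else 0) * (elemGen j).coeff l := by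
    intro l hl
    rw [if_pos (Nat.lt_succ_iff.1 (Finset.mem_range.1 hl)), mul_comm]
  rw [Finset.sum_congr rfl h5]
  have h6 : ∀ n n' : ℕ, (∀ l, n ≤ l →
      (if l ≤ m then completeHom r (m - l) else 0) * (elemGen j).coeff l = 0) → n ≤ n' →
      ∑ l ∈ Finset.range n, (if l ≤ m then completeHom r (m - l) else 0) * (elemGen j).coeff l =
      ∑ l ∈ Finset.range n',
        (if l ≤ m then completeHom r (m - l) else 0) * (elemGen j).coeff l := by
    intro n n' hn hnn
    refine Finset.sum_subset (by simpa using hnn) fun l _ hl => hn l ?_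
    simpa using hl
  rw [h6 (m + 1) (m + r + 1) (fun l hl => by rw [if_neg (by omega), zero_mul]) (by omega),
    h6 (r + 1) (m + r + 1) (fun l hl => by rw [h4 l (by omega), mul_zero]) (by omega)]

lemma alternant_eq_mul (lam : Fin (r + 1) → ℕ) (hlam : ∀ i, i ≠ 0 → lam i = 0) :
    alternant lam = completeHom r (lam 0) *
      (Matrix.of fun l j : Fin (r + 1) => (elemGen j).coeff (Fin.rev l : ℕ)).det := by
  let A : Matrix (Fin (r + 1)) (Fin (r + 1)) (MvPolynomial (Fin (r + 1)) ℤ) :=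
    Matrix.of fun i l => if (Fin.rev l : ℕ) ≤ lam i + (Fin.rev i : ℕ) then
      completeHom r (lam i + (Fin.rev i : ℕ) - (Fin.rev l : ℕ)) else 0
  have hmul : (Matrix.of fun i j : Fin (r + 1) =>
      (X j : MvPolynomial (Fin (r + 1)) ℤ) ^ (lam i + (Fin.rev i : ℕ))) =
      A * Matrix.of fun l j : Fin (r + 1) => (elemGen j).coeff (Fin.rev l : ℕ) := by
    ext1 i j
    rw [Matrix.mul_apply, Matrix.of_apply, pow_eq_sum_completeHom,
      ← Equiv.sum_comp Fin.revPerm]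
    rfl
  have hA : A.IsUpperTriangular := by
    intro i l hli
    have hli' : l < i := hli
    have h0 : lam i = 0 := hlam i (Fin.ne_zero_of_lt hli')
    have hrev : (Fin.rev i : ℕ) < Fin.rev l := Fin.rev_lt_rev.2 hli'
    exact if_neg (by omega)
  have hdet : A.det = completeHom r (lam 0) := by
    rw [Matrix.det_of_isUpperTriangular hA, Fin.prod_univ_succ, Finset.prod_eq_one, mul_one]
    · simp [A]
    · intro i _
      simp [A, hlam _ (Fin.succ_ne_zero i), completeHom_zero]
  rw [alternant, hmul, Matrix.det_mul, hdet]

lemma alternant_zero_ne_zero : alternant (fun _ : Fin (r + 1) => 0) ≠ 0 := by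
  have h := det_card_gt_vandermonde fun j : Fin (r + 1) => (X j : MvPolynomial (Fin (r + 1)) ℤ)
  have h2 : alternant (fun _ : Fin (r + 1) => 0) = (Matrix.of fun i j : Fin (r + 1) =>
      (X j : MvPolynomial (Fin (r + 1)) ℤ) ^ (Finset.univ.filter fun l => i < l).card).det := by
    rw [alternant]
    congr 2
    funext i j
    congr 1
    have : (Finset.univ.filter fun l => i < l) = Finset.Ioi i := by ext; simp
    rw [zero_add, this, Fin.card_Ioi, Fin.val_rev]
    omega
  rw [h2]
  refine Eq.trans_ne (by congr!) (h.trans_ne ?_)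
  rw [Finset.prod_ne_zero_iff]
  intro p hp
  have hp' : p.1 ≠ p.2 := (Finset.mem_filter.1 hp).2.ne
  exact sub_ne_zero.2 fun h => hp' (X_injective h)

lemma schur_single (k : ℕ) : schur (Pi.single (0 : Fin (r + 1)) k) = completeHom r k := by
  have h0 := alternant_eq_mul (r := r) (fun _ => 0) fun _ _ => rfl
  have h1 := alternant_eq_mul (r := r) (Pi.single 0 k) fun i hi => by simp [hi]
  rw [completeHom_zero, one_mul] at h0
  rw [← h0, Pi.single_eq_same] at h1
  have hex : ∃ S : MvPolynomial (Fin (r + 1)) ℤ,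
      S * alternant (fun _ : Fin (r + 1) => 0) = alternant (Pi.single 0 k) := ⟨_, h1.symm⟩
  have := Classical.epsilon_spec hex
  exact mul_right_cancel₀ alternant_zero_ne_zero (this.trans h1)

end Schur

/-! ### Restricted-occupancy coefficients as weight multiplicities -/

section Occupancy

variable {r : ℕ}

/-- The exponents `∑_{i > a} d_i`. -/
def tailExponent (d : Fin (r + 1) →₀ ℕ) : Fin r →₀ ℕ :=
  Finsupp.equivFunOnFinite.symm fun a => ∑ i with a.castSucc < i, d i

lemma tailExponent_apply (d : Fin (r + 1) →₀ ℕ) (a : Fin r) :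
    tailExponent d a = ∑ i with a.castSucc < i, d i := rfl

lemma tailExponent_sum {ι : Type*} (s : Finset ι) (d : ι → Fin (r + 1) →₀ ℕ) :
    tailExponent (∑ n ∈ s, d n) = ∑ n ∈ s, tailExponent (d n) := by
  ext a
  simp only [tailExponent_apply, Finsupp.finsetSum_apply]
  exact Finset.sum_comm

lemma aeval_monomial_tail (d : Fin (r + 1) →₀ ℕ) :
    aeval (fun i : Fin (r + 1) => ∏ a : Fin r with a.castSucc < i,
      (X a : MvPolynomial (Fin r) ℤ)) (monomial d (1 : ℤ)) = monomial (tailExponent d) 1 := by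
  rw [aeval_monomial, map_one, one_mul, Finsupp.prod_fintype _ _ (by simp), monomial_eq, C_1,
    one_mul, Finsupp.prod_fintype _ _ (by simp)]
  simp only [tailExponent_apply, ← Finset.prod_pow_eq_pow_sum, ← Finset.prod_pow,
    Finset.prod_filter]
  rw [Finset.prod_comm]
  refine Finset.prod_congr rfl fun a _ => Finset.prod_congr rfl fun i _ => ?_
  split_ifs <;> simp

lemma genFun_eq_sum (r k L : ℕ) :
    genFun r k L = ∑ c : Fin L → SiteIndex r k, monomial (tailExponent (chainWeight c)) 1 := by
  rw [genFun, schur_single, completeHom, map_sum]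
  simp only [aeval_monomial_tail]
  rw [Fintype.sum_pow]
  refine Finset.sum_congr rfl fun c _ => ?_
  rw [chainWeight, tailExponent_sum, monomial_sum_one]

lemma sum_chainWeight {k L : ℕ} (c : Fin L → SiteIndex r k) : ∑ i, chainWeight c i = k * L := by
  simp only [chainWeight, Finsupp.finsetSum_apply]
  rw [Finset.sum_comm]
  simp [SiteIndex.sum_eq, mul_comm]

lemma rows_tailExponent {k L : ℕ} {d : Fin (r + 1) →₀ ℕ} (hd : ∑ i, d i = k * L)
    (i : Fin (r + 1)) : rows k L (fun a => (tailExponent d a : ℤ)) i = d i := by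
  have h1 : (Fin.cons ((k : ℤ) * L) (fun a => (tailExponent d a : ℤ)) : Fin (r + 1) → ℤ) i =
      ((∑ j with i ≤ j, d j : ℕ) : ℤ) := by
    refine Fin.cases ?_ (fun a => ?_) i
    · have := congrArg (Nat.cast : ℕ → ℤ) hd
      push_cast at this
      simpa using this.symm
    · rw [Fin.cons_succ, tailExponent_apply]
      simp only [Fin.castSucc_lt_iff_succ_le]
  have h2 : (Fin.snoc (fun a => (tailExponent d a : ℤ)) 0 : Fin (r + 1) → ℤ) i =
      ((∑ j with i < j, d j : ℕ) : ℤ) := by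
    refine Fin.lastCases ?_ (fun a => ?_) i
    · simp [Fin.not_lt.2 (Fin.le_last _)]
    · rw [Fin.snoc_castSucc, tailExponent_apply]
  have h3 : ∑ j with i ≤ j, d j = d i + ∑ j with i < j, d j := by
    have : (Finset.univ.filter fun j => i ≤ j) = insert i (Finset.univ.filter fun j => i < j) := by
      ext j
      simp [le_iff_eq_or_lt, eq_comm]
    rw [this, Finset.sum_insert (by simp)]
  rw [rows, h1, h2, h3]
  push_cast
  ring

lemma rows_injective (k L : ℕ) : Function.Injective (rows k L : (Fin r → ℤ) → Fin (r + 1) → ℤ) := by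
  intro M M' h
  have key : ∀ i : Fin (r + 1), (Fin.cons ((k : ℤ) * L) M : Fin (r + 1) → ℤ) i =
      (Fin.cons ((k : ℤ) * L) M' : Fin (r + 1) → ℤ) i := by
    intro i
    induction i using Fin.induction with
    | zero => simp
    | succ a ih =>
      have h1 := congrFun h a.castSucc
      simp only [rows, Fin.snoc_castSucc, ih] at h1
      simpa using h1
  funext a
  simpa using key a.succ

lemma wtInt_eq_rows_iff {k L : ℕ} (c : Fin L → SiteIndex r k) (M : Fin r → ℤ) :
    (chainModule r k L).wtInt c = rows k L M ↔ ∀ a, (tailExponent (chainWeight c) a : ℤ) = M a := by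
  have h : rows k L (fun a => (tailExponent (chainWeight c) a : ℤ)) =
      (chainModule r k L).wtInt c := funext fun i => rows_tailExponent (sum_chainWeight c) i
  rw [← h, (rows_injective k L).eq_iff, funext_iff]

open scoped Classical in
lemma occupancy_eq_card (r k L : ℕ) (M : Fin r → ℤ) :
    occupancy r k L M =
      (Finset.univ.filter fun c => (chainModule r k L).wtInt c = rows k L M).card := by
  simp only [wtInt_eq_rows_iff]
  rw [occupancy]
  split_ifs with hM
  · rw [genFun_eq_sum, coeff_sum]
    simp only [coeff_monomial, Finset.sum_boole]
    congr 3
    ext c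
    simp only [DFunLike.ext_iff, Finsupp.coe_equivFunOnFinite_symm]
    refine forall_congr' fun a => ?_
    have := hM a
    omega
  · push Not at hM
    obtain ⟨a, ha⟩ := hM
    rw [Finset.filter_false_of_mem]
    · simp
    · intro c _ h
      have := h a
      omega

end Occupancy

end

end PartialTwist

namespace PartialTwist

noncomputable section

open MvPolynomial

/-! ### The shift operator -/

section Shift

variable {r : ℕ}

/-- The exponent of `t^α`. -/
def rootExponent (p : Fin (r + 1) × Fin (r + 1)) : Fin r →₀ ℕ :=
  Finsupp.equivFunOnFinite.symm fun a => if p.1 ≤ a.castSucc ∧ a.castSucc < p.2 then 1 else 0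

lemma rootExponent_apply (p : Fin (r + 1) × Fin (r + 1)) (a : Fin r) :
    rootExponent p a = if p.1 ≤ a.castSucc ∧ a.castSucc < p.2 then 1 else 0 := rfl

lemma rootMonomial_eq (α : PosRoot r) : rootMonomial α = monomial (rootExponent α.1) 1 := by
  rw [rootMonomial, monomial_eq, C_1, one_mul, Finsupp.prod_fintype _ _ (by simp),
    Finset.prod_filter]
  refine Finset.prod_congr rfl fun a _ => ?_
  rw [rootExponent_apply]
  split_ifs <;> simp

lemma rows_sub (k L : ℕ) (M x : Fin r → ℤ) :
    rows k L (fun a => M a - x a) = rows k L M - rows 0 0 x := by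
  funext i
  have h1 : (Fin.cons ((k : ℤ) * L) (fun a => M a - x a) : Fin (r + 1) → ℤ) i =
      (Fin.cons ((k : ℤ) * L) M : Fin (r + 1) → ℤ) i - (Fin.cons 0 x : Fin (r + 1) → ℤ) i := by
    refine Fin.cases ?_ (fun a => ?_) i <;> simp
  have h2 : (Fin.snoc (fun a => M a - x a) 0 : Fin (r + 1) → ℤ) i =
      (Fin.snoc M 0 : Fin (r + 1) → ℤ) i - (Fin.snoc x 0 : Fin (r + 1) → ℤ) i := by
    refine Fin.lastCases ?_ (fun a => ?_) i <;> simp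
  simp only [rows, Pi.sub_apply, h1, h2, Nat.cast_zero, zero_mul]
  ring

lemma rows_rootExponent {p : Fin (r + 1) × Fin (r + 1)} (hp : p.1 < p.2) :
    rows 0 0 (fun a => (rootExponent p a : ℤ)) = -rootVec p := by
  funext i
  have h1 : (Fin.cons 0 (fun a => (rootExponent p a : ℤ)) : Fin (r + 1) → ℤ) i =
      if p.1 < i ∧ i ≤ p.2 then 1 else 0 := by
    refine Fin.cases ?_ (fun a => ?_) i
    · simp
    · rw [Fin.cons_succ, rootExponent_apply]
      simp only [Fin.le_castSucc_iff, Fin.castSucc_lt_iff_succ_le]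
      split_ifs <;> rfl
  have h2 : (Fin.snoc (fun a => (rootExponent p a : ℤ)) 0 : Fin (r + 1) → ℤ) i =
      if p.1 ≤ i ∧ i < p.2 then 1 else 0 := by
    refine Fin.lastCases ?_ (fun a => ?_) i
    · simp [Fin.not_lt.2 (Fin.le_last _)]
    · rw [Fin.snoc_castSucc, rootExponent_apply]
      split_ifs <;> rfl
  simp only [rows, Nat.cast_zero, zero_mul, h1, h2, Pi.neg_apply, rootVec, Pi.sub_apply,
    Pi.single_apply]
  simp only [Fin.ext_iff, Fin.lt_def, Fin.le_def] at hp ⊢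
  split_ifs <;> omega

lemma rows_neg_sum_rootExponent {P : Setoid (Fin (r + 1))}
    {S : Finset (Fin (r + 1) × Fin (r + 1))} (hS : S ⊆ blockPairs P) :
    rows 0 0 (fun a => ((∑ p ∈ S, rootExponent p) a : ℤ)) = -rootSum S := by
  classical
  induction S using Finset.induction_on with
  | empty =>
    funext i
    have := congrFun (rows_sub 0 0 (0 : Fin r → ℤ) 0) i
    simp only [sub_self, Pi.zero_apply] at this
    simpa [rootSum] using this
  | insert p S hpS ih =>
    have hp := ((mem_blockPairs P).1 (hS (Finset.mem_insert_self p S))).1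
    have h0 := ih ((Finset.subset_insert p S).trans hS)
    have h1 := rows_sub 0 0 (fun a => ((∑ q ∈ insert p S, rootExponent q) a : ℤ))
      fun a => (rootExponent p a : ℤ)
    rw [rows_rootExponent hp] at h1
    have h2 : (fun a => ((∑ q ∈ insert p S, rootExponent q) a : ℤ) - (rootExponent p a : ℤ)) =
        fun a => ((∑ q ∈ S, rootExponent q) a : ℤ) := by
      funext a
      rw [Finset.sum_insert hpS]
      simp
    rw [h2, h0] at h1
    have h3 : rootSum (insert p S) = rootVec p + rootSum S := Finset.sum_insert hpS
    rw [h3, neg_add, h1]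
    abel

lemma rows_sub_sum_rootExponent (k L : ℕ) (M : Fin r → ℤ) {P : Setoid (Fin (r + 1))}
    {S : Finset (Fin (r + 1) × Fin (r + 1))} (hS : S ⊆ blockPairs P) :
    rows k L (fun a => M a - ((∑ p ∈ S, rootExponent p) a : ℤ)) = rows k L M + rootSum S := by
  rw [rows_sub, rows_neg_sum_rootExponent hS, sub_neg_eq_add]

lemma sum_rootExponent_eq_iff {P : Setoid (Fin (r + 1))}
    {S T : Finset (Fin (r + 1) × Fin (r + 1))} (hS : S ⊆ blockPairs P) (hT : T ⊆ blockPairs P) :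
    ∑ p ∈ S, rootExponent p = ∑ p ∈ T, rootExponent p ↔
      denominatorExponent P S = denominatorExponent P T := by
  have h1 : ∑ p ∈ S, rootExponent p = ∑ p ∈ T, rootExponent p ↔ rootSum S = rootSum T := by
    rw [← neg_inj (a := rootSum S), ← rows_neg_sum_rootExponent hS, ← rows_neg_sum_rootExponent hT,
      (rows_injective 0 0).eq_iff, funext_iff, DFunLike.ext_iff]
    exact forall_congr' fun a => Nat.cast_inj.symm
  rw [h1, funext_iff, DFunLike.ext_iff]
  refine forall_congr' fun i => ?_
  have h2 := denominatorExponent_apply hS i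
  have h3 := denominatorExponent_apply hT i
  omega

lemma prod_charInv (D : Set (PosRoot r)) :
    ∏ j : Component D, charInv D j = ∑ S ∈ (blockPairs (blocks D)).powerset,
      monomial (∑ p ∈ S, rootExponent p) ((-1) ^ S.card : ℤ) := by
  classical
  have h1 : ∏ j : Component D, charInv D j =
      ∏ p ∈ blockPairs (blocks D), (1 - monomial (rootExponent p) (1 : ℤ)) := by
    simp only [charInv, Finset.prod_filter]
    rw [Finset.prod_comm]
    have h2 : ∀ α : PosRoot r, (∏ j : Component D,
        if α ∈ componentRoots D j then 1 - rootMonomial α else 1) =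
        if blocks D α.1.1 α.1.2 then 1 - monomial (rootExponent α.1) (1 : ℤ) else 1 := by
      intro α
      rw [rootMonomial_eq]
      split_ifs with h
      · have h3 : ∀ j : Component D, α ∈ componentRoots D j ↔
            Quotient.mk (blocks D) α.1.1 = j := fun j =>
          ⟨fun hj => hj.1, fun hj => ⟨hj, (Quotient.sound h).symm.trans hj⟩⟩
        simp only [h3, Finset.prod_ite_eq, Finset.mem_univ, if_true]
      · refine Finset.prod_eq_one fun j _ => if_neg fun hj => h ?_
        exact Quotient.exact (hj.1.trans hj.2.symm)
    rw [Finset.prod_congr rfl fun α _ => h2 α]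
    rw [blockPairs, ← Finset.prod_filter]
    refine Finset.prod_bij (fun α _ => α.1) ?_ ?_ ?_ ?_
    · intro α hα
      simpa using ⟨α.2, (Finset.mem_filter.1 hα).2⟩
    · intro α _ β _ h
      exact Subtype.ext h
    · intro p hp
      have hp' := (Finset.mem_filter.1 hp).2
      exact ⟨⟨p, hp'.1⟩, by simpa using hp'.2, rfl⟩
    · intro α _
      rfl
  rw [h1, Finset.prod_sub]
  refine Finset.sum_congr rfl fun S _ => ?_
  rw [Finset.prod_const_one, mul_one, ← monomial_sum_one, ← C_1, ← C_neg, ← C_pow, C_mul_monomial,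
    mul_one]

lemma shift_prod_charInv (D : Set (PosRoot r)) (f : (Fin r → ℤ) → ℤ) (M : Fin r → ℤ) :
    shift (∏ j : Component D, charInv D j) f M =
      ∑ S ∈ (blockPairs (blocks D)).powerset, (-1) ^ S.card *
        f (fun a => M a - ((∑ p ∈ S, rootExponent p) a : ℤ)) := by
  classical
  set Q := ∏ j : Component D, charInv D j with hQ
  rw [prod_charInv] at hQ
  have hcoeff : ∀ β, Q.coeff β = ∑ S ∈ (blockPairs (blocks D)).powerset,
      if ∑ p ∈ S, rootExponent p = β then (-1) ^ S.card else 0 := by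
    intro β
    rw [hQ, coeff_sum]
    simp only [coeff_monomial]
  have hsign : ∀ S ∈ (blockPairs (blocks D)).powerset,
      Int.sign (Q.coeff (∑ p ∈ S, rootExponent p)) = Q.coeff (∑ p ∈ S, rootExponent p) := by
    intro S hS
    have : Q.coeff (∑ p ∈ S, rootExponent p) =
        (blockVandermonde (blocks D) ℤ).coeff (denominatorExponent (blocks D) S) := by
      rw [hcoeff, blockVandermonde_eq_sum_powerset, coeff_sum]
      refine Finset.sum_congr rfl fun T hT => ?_
      rw [coeff_monomial]
      simp only [sum_rootExponent_eq_iff (Finset.mem_powerset.1 hT) (Finset.mem_powerset.1 hS)]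
    rw [this, sign_coeff_blockVandermonde]
  have hsub : Q.support ⊆
      (blockPairs (blocks D)).powerset.image fun S => ∑ p ∈ S, rootExponent p := by
    intro β hβ
    rw [mem_support_iff, hcoeff] at hβ
    obtain ⟨S, hS, hS0⟩ := Finset.exists_ne_zero_of_sum_ne_zero hβ
    refine Finset.mem_image.2 ⟨S, hS, ?_⟩
    by_contra h
    exact hS0 (if_neg h)
  rw [shift, Finset.sum_subset hsub fun β _ hβ => by
    rw [notMem_support_iff.1 hβ, Int.sign_zero, zero_mul]]
  have h1 : ∀ β ∈ (blockPairs (blocks D)).powerset.image fun S => ∑ p ∈ S, rootExponent p,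
      Int.sign (Q.coeff β) * f (fun a => M a - (β a : ℤ)) =
      ∑ S ∈ (blockPairs (blocks D)).powerset, if ∑ p ∈ S, rootExponent p = β then
        (-1) ^ S.card * f (fun a => M a - ((∑ p ∈ S, rootExponent p) a : ℤ)) else 0 := by
    intro β hβ
    obtain ⟨S, hS, rfl⟩ := Finset.mem_image.1 hβ
    rw [hsign S hS, hcoeff, Finset.sum_mul]
    refine Finset.sum_congr rfl fun T _ => ?_
    split_ifs with h
    · rw [h]
    · rw [zero_mul]
  rw [Finset.sum_congr rfl h1, Finset.sum_comm]
  refine Finset.sum_congr rfl fun S hS => ?_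
  rw [Finset.sum_ite_eq, if_pos (Finset.mem_image_of_mem _ hS)]

end Shift

/-! ### The chain as a representation of the unbroken subalgebra -/

section Chain

variable {r k L : ℕ} {D : Set (PosRoot r)}

lemma chainAct_one : chainAct k L (1 : Matrix (Fin (r + 1)) (Fin (r + 1)) ℂ) =
    ((k * L : ℕ) : ℂ) • LinearMap.id := by
  refine (chainBasis r k L).ext fun c => ?_
  have h1 : (1 : Matrix (Fin (r + 1)) (Fin (r + 1)) ℂ) = ∑ i, Matrix.single i i 1 := by
    rw [Matrix.sum_single_one]
  rw [h1, ← chainActLin_apply, map_sum, LinearMap.sum_apply]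
  simp only [chainActLin_apply, chainAct_diag, ← Finset.sum_smul, ← Nat.cast_sum, sum_chainWeight]
  rfl

lemma single_diag_mem {K : Submodule ℂ (Matrix (Fin (r + 1)) (Fin (r + 1)) ℂ)}
    (h1 : (1 : Matrix (Fin (r + 1)) (Fin (r + 1)) ℂ) ∈ K)
    (hK : ∀ p q : Fin (r + 1),
      Complex.I • (Matrix.single p p (1 : ℂ) - Matrix.single q q 1) ∈ K) (p : Fin (r + 1)) :
    Matrix.single p p (1 : ℂ) ∈ K := by
  have h2 : ∀ q : Fin (r + 1), Matrix.single p p (1 : ℂ) - Matrix.single q q 1 ∈ K := by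
    intro q
    have := K.smul_mem (-Complex.I) (hK p q)
    rwa [smul_smul, neg_mul, Complex.I_mul_I, neg_neg, one_smul] at this
  have h3 : ((r + 1 : ℕ) : ℂ) • Matrix.single p p (1 : ℂ) ∈ K := by
    have : ((r + 1 : ℕ) : ℂ) • Matrix.single p p (1 : ℂ) =
        ∑ q : Fin (r + 1), (Matrix.single p p (1 : ℂ) - Matrix.single q q 1) + 1 := by
      rw [Finset.sum_sub_distrib, Matrix.sum_single_one, sub_add_cancel, Finset.sum_const,
        Finset.card_univ, Fintype.card_fin, Nat.cast_smul_eq_nsmul]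
    rw [this]
    exact add_mem (sum_mem fun q _ => h2 q) h1
  exact (K.smul_mem_iff (Nat.cast_ne_zero.2 (Nat.succ_ne_zero r))).1 h3

lemma I_smul_diag_mem_unbroken (D : Set (PosRoot r)) (p q : Fin (r + 1)) :
    Complex.I • (Matrix.single p p (1 : ℂ) - Matrix.single q q 1) ∈ unbroken D := by
  refine ⟨⟨?_, ?_⟩, fun i l h => ?_⟩
  · rw [Matrix.conjTranspose_smul, Matrix.conjTranspose_sub, Matrix.conjTranspose_single,
      Matrix.conjTranspose_single]
    simp
  · simp
  · have hil : i ≠ l := fun h' => h (h' ▸ (blocks D).refl' i)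
    simp only [Matrix.smul_apply, Matrix.sub_apply, Matrix.single_apply]
    rw [if_neg fun h' => hil (h'.1.symm.trans h'.2), if_neg fun h' => hil (h'.1.symm.trans h'.2)]
    simp

lemma single_mem_of_unbroken_le {K : Submodule ℂ (Matrix (Fin (r + 1)) (Fin (r + 1)) ℂ)}
    (h1 : (1 : Matrix (Fin (r + 1)) (Fin (r + 1)) ℂ) ∈ K) (hK : ∀ A ∈ unbroken D, A ∈ K)
    {i l : Fin (r + 1)} (hil : blocks D i l) : Matrix.single i l (1 : ℂ) ∈ K := by
  rcases eq_or_ne i l with rfl | hne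
  · exact single_diag_mem h1 (fun p q => hK _ (I_smul_diag_mem_unbroken D p q)) i
  have hsupp : ∀ a b : ℂ, ∀ p q, ¬ blocks D p q →
      (Matrix.single i l a + Matrix.single l i b) p q = 0 := by
    intro a b p q h
    rw [Matrix.add_apply, Matrix.single_apply, Matrix.single_apply, if_neg, if_neg, add_zero]
    · rintro ⟨rfl, rfl⟩
      exact h ((blocks D).symm' hil)
    · rintro ⟨rfl, rfl⟩
      exact h hil
  have hmem : ∀ a b : ℂ, starRingEnd ℂ a = -b →
      Matrix.single i l a + Matrix.single l i b ∈ unbroken D := by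
    intro a b hab
    refine ⟨⟨?_, ?_⟩, hsupp a b⟩
    · have hba : starRingEnd ℂ b = -a := by
        rw [← neg_neg b, ← hab, map_neg, Complex.conj_conj]
      rw [Matrix.conjTranspose_add, Matrix.conjTranspose_single, Matrix.conjTranspose_single,
        neg_add, add_comm (Matrix.single l i _), Matrix.single_neg, Matrix.single_neg]
      exact congrArg₂ _ (congrArg _ hba) (congrArg _ hab)
    · rw [Matrix.trace_add, Matrix.trace_single_eq_of_ne _ _ _ hne,
        Matrix.trace_single_eq_of_ne _ _ _ hne.symm, add_zero]
  have hA := hK _ (hmem 1 (-1) (by simp))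
  have hB := hK _ (hmem Complex.I Complex.I (by simp))
  have := K.smul_mem (1 / 2 : ℂ) (sub_mem hA (K.smul_mem Complex.I hB))
  convert this using 1
  ext p q
  simp only [Matrix.smul_apply, Matrix.sub_apply, Matrix.add_apply, Matrix.single_apply,
    smul_eq_mul]
  split_ifs <;> ring_nf <;> simp <;> ring

lemma isInvariant_iff {W : Submodule ℂ (Chain r k L)} :
    IsInvariant D W ↔ (chainModule r k L).Invariant (blocks D) W := by
  constructor
  · intro h i l hil v hv
    let K : Submodule ℂ (Matrix (Fin (r + 1)) (Fin (r + 1)) ℂ) :=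
      W.comap ((LinearMap.applyₗ v).comp (chainActLin k L))
    have hmem : ∀ A, A ∈ K ↔ chainAct k L A v ∈ W := by
      intro A
      rw [← chainActLin_apply]
      rfl
    refine (hmem _).1 (single_mem_of_unbroken_le ((hmem _).2 ?_)
      (fun A hA => (hmem _).2 (h A hA v hv)) hil)
    rw [chainAct_one]
    exact W.smul_mem _ hv
  · intro h A hA v hv
    rw [chainAct_eq_sum, LinearMap.sum_apply]
    refine sum_mem fun i _ => ?_
    rw [LinearMap.sum_apply]
    refine sum_mem fun l _ => ?_
    by_cases hil : blocks D i l
    · exact W.smul_mem _ (h i l hil v hv)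
    · rw [hA.2 i l hil, zero_smul]
      exact zero_mem _

lemma isIrreducible_iff {W : Submodule ℂ (Chain r k L)} :
    IsIrreducible D W ↔ (chainModule r k L).Irreducible (blocks D) W := by
  simp only [IsIrreducible, UnitaryGlModule.Irreducible, isInvariant_iff]

lemma sum_rows (k L : ℕ) (M : Fin r → ℤ) : ∑ i, rows k L M i = ((k * L : ℕ) : ℤ) := by
  simp only [rows, Finset.sum_sub_distrib]
  rw [Fin.sum_univ_succ, Fin.sum_univ_castSucc]
  simp

open scoped Classical in
lemma sum_restrictedDiagrams (lam : Fin (r + 1) → ℤ)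
    (A : Matrix (Fin (r + 1)) (Fin (r + 1)) ℂ) :
    ∑ j, ∑ i, A i.1 i.1 * (restrictedDiagrams D lam j i : ℂ) = ∑ i, A i i * (lam i : ℂ) := by
  refine Eq.trans ?_ (Fintype.sum_fiberwise (Quotient.mk (blocks D)) fun i => A i i * (lam i : ℂ))
  congr!

lemma hasHighestWeight_iff {W : Submodule ℂ (Chain r k L)} {M : Fin r → ℤ} :
    HasHighestWeight D W (restrictedDiagrams D (rows k L M)) ↔
      ∃ v ∈ W, (chainModule r k L).IsHighest (blocks D) (rows k L M) v := by
  refine exists_congr fun v => and_congr_right fun _ => and_congr_right fun hv0 => and_congr ?_ ?_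
  · constructor
    · intro h i l hil hP
      exact h (Quotient.mk _ i) ⟨(i, l), hil⟩ ⟨rfl, (Quotient.sound hP).symm⟩
    · intro h j α hα
      exact h _ _ α.2 (Quotient.exact (hα.1.trans hα.2.symm))
  · simp only [sum_restrictedDiagrams]
    constructor
    · intro h i
      let φ : Matrix (Fin (r + 1)) (Fin (r + 1)) ℂ →ₗ[ℂ] Chain r k L :=
        (LinearMap.applyₗ v).comp (chainActLin k L) -
          (∑ i, (rows k L M i : ℂ) • Matrix.entryLinearMap ℂ ℂ i i).smulRight v
      have hφ : ∀ A, A ∈ LinearMap.ker φ ↔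
          chainAct k L A v = (∑ i, A i i * (rows k L M i : ℂ)) • v := by
        intro A
        rw [LinearMap.mem_ker, LinearMap.sub_apply, sub_eq_zero, ← chainActLin_apply]
        simp [mul_comm]
      have h1 := (hφ _).1 (single_diag_mem ((hφ 1).2 ?_) (fun p q => (hφ _).2 ?_) i)
      · refine h1.trans ?_
        congr 1
        rw [Finset.sum_eq_single i]
        · simp
        · intro j _ hj
          simp [hj.symm]
        · simp
      · rw [chainAct_one]
        simp only [Matrix.one_apply_eq, one_mul, ← Int.cast_sum, sum_rows]
        simp
      · refine h _ (I_smul_diag_mem_unbroken D p q) fun a b hab => ?_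
        simp only [Matrix.smul_apply, Matrix.sub_apply, Matrix.single_apply]
        rw [if_neg fun h' => hab (h'.1.symm.trans h'.2),
          if_neg fun h' => hab (h'.1.symm.trans h'.2)]
        simp
    · intro h A _ hA
      rw [chainAct_eq_sum, LinearMap.sum_apply, Finset.sum_smul]
      refine Finset.sum_congr rfl fun i _ => ?_
      rw [LinearMap.sum_apply, Finset.sum_eq_single i]
      · have := h i
        rw [LinearMap.smul_apply, mul_smul, ← this]
        rfl
      · intro l _ hl
        rw [hA hl.symm, zero_smul, LinearMap.zero_apply]
      · simp

end Chain

lemma blockPairs_blocks_empty {r : ℕ} : blockPairs (blocks (∅ : Set (PosRoot r))) = ∅ := by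
  refine Finset.eq_empty_of_forall_notMem fun p hp => ?_
  obtain ⟨h1, h2⟩ := (mem_blockPairs _).1 hp
  have h3 : blocks (∅ : Set (PosRoot r)) ≤ ⊥ := sInf_le fun α hα => absurd hα (by simp)
  exact h1.ne (h3 h2)

end

end PartialTwist

open PartialTwist in
theorem mainTheorem3 (r k L : ℕ) (D : Set (PosRoot r)) (M : Fin r → ℤ)
    (hLam : ∀ j : Component D, IsYoungDiagram (restrictedDiagrams D (rows k L M) j)) :
    (∃ (m : ℕ) (W : Fin m → Submodule ℂ (Chain r k L)), IsIrreducibleDecomposition D W) ∧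
    ∀ (m : ℕ) (W : Fin m → Submodule ℂ (Chain r k L)), IsIrreducibleDecomposition D W →
      (multiplicity D W (restrictedDiagrams D (rows k L M)) : ℤ) =
          shift (∏ j : Component D, charInv D j) (occupancy r k L) M ∧
        (D = ∅ →
          (multiplicity D W (restrictedDiagrams D (rows k L M)) : ℤ) = occupancy r k L M) := by
  classical
  refine ⟨?_, fun m W hW => ?_⟩
  · obtain ⟨m, W, hirr, hint⟩ := (chainModule r k L).exists_isInternal (blocks D)
    exact ⟨m, W, fun a => isIrreducible_iff.2 (hirr a), hint⟩
  have hdom : ∀ p ∈ blockPairs (blocks D), rows k L M p.2 ≤ rows k L M p.1 := by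
    intro p hp
    obtain ⟨h1, h2⟩ := (mem_blockPairs _).1 hp
    have h3 : (⟨p.1, rfl⟩ : {i // Quotient.mk (blocks D) i = Quotient.mk (blocks D) p.1}) ≤
        ⟨p.2, (Quotient.sound h2).symm⟩ := h1.le
    exact (hLam _).1 h3
  have hpos : ∀ i, 0 ≤ rows k L M i := fun i => (hLam (Quotient.mk _ i)).2 ⟨i, rfl⟩
  have hcard : (multiplicity D W (restrictedDiagrams D (rows k L M)) : ℤ) =
      ∑ S ∈ (blockPairs (blocks D)).powerset, (-1 : ℤ) ^ S.card *
        ((Finset.univ.filter fun c =>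
          (chainModule r k L).wtInt c = rows k L M + rootSum S).card : ℤ) := by
    rw [← UnitaryGlModule.card_isHighest (fun a => isIrreducible_iff.1 (hW.1 a)) hW.2 hdom hpos,
      PartialTwist.multiplicity]
    simp only [hasHighestWeight_iff]
  refine ⟨?_, ?_⟩
  · rw [hcard, shift_prod_charInv]
    refine Finset.sum_congr rfl fun S hS => ?_
    rw [occupancy_eq_card, rows_sub_sum_rootExponent k L M (Finset.mem_powerset.1 hS)]
  · rintro rfl
    rw [hcard, blockPairs_blocks_empty, Finset.powerset_empty, Finset.sum_singleton,
      occupancy_eq_card]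
    simp only [Finset.card_empty, pow_zero, one_mul, rootSum, Finset.sum_empty, add_zero]
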